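/- For a probability measure $\mu$ on $\mathbb{R}^n$ and a nonnegative function $f$, write $\mathrm{Ent}_\mu(f)=\int f\log f\,d\mu-\big(\int f\,d\mu\big)\log\big(\int f\,d\mu\big)$. For $a\in(0,1)$, $\mu$ satisfies the generalized Beckner inequality $\mathrm{GBI}(a)$ with constant $C$ if $$\sup_{p\in(1,2)}\frac{\int f^2\,d\mu-\big(\int |f|^p\,d\mu\big)^{2/p}}{(2-p)^a}\le C\int|\nabla f|^2\,d\mu$$ for all $C^1$ functions $f$ with $f,|\nabla f|\in L^2(\mu)$. Let $a\in(0,1)$ and $C>0$. There exists a constant $C'_a>0$, depending only on $a$ and $C$, such that the following holds. Let $n\ge 0$, let $U:\mathbb{R}^n\to\mathbb{R}$ be continuous with $\int e^{-U}dx=1$, and assume that $\mu(dx)=e^{-U(x)}dx$ satisfies $\mathrm{GBI}(a)$ with constant $C$. Let $(P_t)_{t\ge0}$ be the semigroup on $L^2(\mu)$ associated with the closure of the Dirichlet form $\frac12\int|\nabla\varphi|^2d\mu$, $\varphi\in C_c^\infty(\mathbb{R}^n)$ (for smooth $U$, its generator is $\frac12(\Delta-\nabla U\cdot\nabla)$,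 and it is the transition semigroup of $dX_t=dB_t-\frac12\nabla U(X_t)\,dt$). Let $h$ be a bounded probability density with respect to $\mu$, let $H=\mathrm{Ent}_\mu(h)$, and let $K$ satisfy $$K\ge e^2,\qquad \log K\ge 4H .$$ Then, for all $t\ge0$, $$\mathrm{Ent}_\mu\big(P_t(h\mathbf 1_{h\le K})\big)\le H\,\exp\left(-\frac{t}{C'_a\,\log^{1-a}K}\right).$$ -/

import Mathlib

open MeasureTheory Filter Topology
open scoped ContDiff Gradient

namespace Beckner

/-- The (finite-volume Gibbs) measure `exp (-U x) dx` on `ℝ^ι`; the normalizing constant is part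
of `U`. -/
noncomputable def gibbs {ι : Type} [Fintype ι] (U : EuclideanSpace ℝ ι → ℝ) :
    Measure (EuclideanSpace ℝ ι) :=
  volume.withDensity fun x => ENNReal.ofReal (Real.exp (-U x))

/-- Entropy of a nonnegative function `f`: `∫ f log f dμ - (∫ f dμ) log (∫ f dμ)`. -/
noncomputable def entropy {X : Type} [MeasurableSpace X] (μ : Measure X) (f : X → ℝ) : ℝ :=
  ∫ x, f x * Real.log (f x) ∂μ - (∫ x, f x ∂μ) * Real.log (∫ x, f x ∂μ)

/-- The generalized Beckner inequality `GBI(a)` with constant `C`: for every `C¹` function `f` such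
that both sides make sense and every `p ∈ (1, 2)`,
`(∫ f² dμ - (∫ |f|^p dμ)^(2/p)) / (2 - p)^a ≤ C ∫ |∇f|² dμ`. -/
def GBI {ι : Type} [Fintype ι] (μ : Measure (EuclideanSpace ℝ ι)) (a C : ℝ) : Prop :=
  ∀ f : EuclideanSpace ℝ ι → ℝ, ContDiff ℝ 1 f → MemLp f 2 μ → MemLp (∇ f) 2 μ →
    ∀ p : ℝ, 1 < p → p < 2 →
      (∫ x, f x ^ 2 ∂μ - (∫ x, |f x| ^ p ∂μ) ^ (2 / p)) / (2 - p) ^ a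
        ≤ C * ∫ x, ‖∇ f x‖ ^ 2 ∂μ

/-- `h` is a bounded probability density with respect to `μ`. -/
structure IsBoundedDensity {X : Type} [MeasurableSpace X] (μ : Measure X) (h : X → ℝ) : Prop where
  aemeasurable : AEMeasurable h μ
  nonneg : ∀ᵐ x ∂μ, 0 ≤ h x
  bounded : ∃ M : ℝ, ∀ᵐ x ∂μ, h x ≤ M
  integral_eq_one : ∫ x, h x ∂μ = 1

/-- The pairs `(φ, c ∇φ)`, `φ` smooth with compact support, as a subspace of the Hilbert space
`L²(μ) × L²(μ; ℝ^ι)` (with the Hilbert product norm). -/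
def gradGraph {ι : Type} [Fintype ι] (μ : Measure (EuclideanSpace ℝ ι)) (c : ℝ) :
    Submodule ℝ (WithLp 2 (Lp ℝ 2 μ × Lp (EuclideanSpace ℝ ι) 2 μ)) where
  carrier := {w | ∃ φ : EuclideanSpace ℝ ι → ℝ, ContDiff ℝ ∞ φ ∧ HasCompactSupport φ ∧
    w.fst =ᵐ[μ] φ ∧ w.snd =ᵐ[μ] fun x => c • ∇ φ x}
  add_mem' := by
    rintro v w ⟨φ, hφ, hφc, h1, h2⟩ ⟨ψ, hψ, hψc, h3, h4⟩
    refine ⟨φ + ψ, hφ.add hψ, hφc.add hψc, ?_, ?_⟩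
    · filter_upwards [Lp.coeFn_add v.fst w.fst, h1, h3] with x hx h1 h3
      simpa [h1, h3] using hx
    · filter_upwards [Lp.coeFn_add v.snd w.snd, h2, h4] with x hx h2 h4
      have hg : ∇ (φ + ψ) x = ∇ φ x + ∇ ψ x := by
        simp only [gradient]
        rw [fderiv_add (hφ.differentiable (by simp) x) (hψ.differentiable (by simp) x), map_add]
      rw [hg, smul_add, ← h2, ← h4]
      simpa using hx
  zero_mem' := by
    refine ⟨0, contDiff_const, HasCompactSupport.zero, ?_, ?_⟩
    · simpa using Lp.coeFn_zero ℝ 2 μ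
    · have hg : ∀ x, ∇ (0 : EuclideanSpace ℝ ι → ℝ) x = 0 := by
        intro x; simp [gradient]
      filter_upwards [Lp.coeFn_zero (EuclideanSpace ℝ ι) 2 μ] with x hx
      rw [hg, smul_zero]
      simpa using hx
  smul_mem' := by
    rintro r w ⟨φ, hφ, hφc, h1, h2⟩
    refine ⟨r • φ, contDiff_const.smul hφ, hφc.smul_left (f := fun _ => r), ?_, ?_⟩
    · filter_upwards [Lp.coeFn_smul r w.fst, h1] with x hx h1
      simpa [h1] using hx
    · filter_upwards [Lp.coeFn_smul r w.snd, h2] with x hx h2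
      have hg : ∇ (r • φ) x = r • ∇ φ x := by
        simp only [gradient]
        rw [fderiv_const_smul (hφ.differentiable (by simp) x), map_smul]
      rw [hg, smul_comm, ← h2]
      simpa using hx

/-- The resolvent `(1 - τ L)⁻¹` on `L²(μ)`, `τ ≥ 0`, where `-L` is the nonnegative self-adjoint
operator of the closure of the Dirichlet form `(φ, ψ) ↦ (1/2) ∫ ∇φ ⬝ ∇ψ dμ` on smooth compactly
supported functions (so `L = (Δ - ∇U ⬝ ∇) / 2` for `μ = exp (-U) dx`). Its value `u` at `f` is the
first component of the orthogonal projection of `(f, 0)` onto the closure of the pairs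
`(φ, √(τ/2) ∇φ)`: that is, `∫ (f - u) φ dμ = (τ/2) ∫ ∇u ⬝ ∇φ dμ` for all `φ`. -/
noncomputable def resolvent {ι : Type} [Fintype ι] (μ : Measure (EuclideanSpace ℝ ι)) (τ : ℝ)
    (f : Lp ℝ 2 μ) : Lp ℝ 2 μ :=
  ((gradGraph μ (Real.sqrt (τ / 2))).topologicalClosure.starProjection
    (WithLp.toLp 2 (f, 0))).fst

/-- The semigroup `P_t = exp (t L)` on `L²(μ)`, through the exponential formula
`P_t f = lim (1 - (t/n) L)⁻ⁿ f` (limit in `L²(μ)`). -/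
noncomputable def semigroupL2 {ι : Type} [Fintype ι] (μ : Measure (EuclideanSpace ℝ ι)) (t : ℝ)
    (f : Lp ℝ 2 μ) : Lp ℝ 2 μ :=
  limUnder (atTop : Filter ℕ) fun n : ℕ => (resolvent μ (t / n))^[n] f

open Classical in
/-- `P_t f` for a square-integrable function `f`. -/
noncomputable def semigroup {ι : Type} [Fintype ι] (μ : Measure (EuclideanSpace ℝ ι)) (t : ℝ)
    (f : EuclideanSpace ℝ ι → ℝ) : EuclideanSpace ℝ ι → ℝ :=
  if hf : MemLp f 2 μ then semigroupL2 μ t hf.toLp else 0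

end Beckner

/-!
The proof never uses the semigroup in continuous time: entropy decay is proved for each implicit
Euler step `u = (1 - τ L)⁻¹ f` and passed to the limit in the exponential formula
`P_t f = lim (1 - (t/n) L)⁻ⁿ f`.

*One step.* By convexity of `x log x`, `Ent f - Ent u ≥ ∫ (f - u) log u dμ`, and testing the weak
resolvent equation against `log u` turns the right side into
`(τ/2) ∫ |∇u|² / u dμ = 2 τ ∫ |∇√u|² dμ`. The generalized Beckner inequality for `√u` with
`p = 2 - 2 δ` bounds this below by a multiple of
`(∫ u - (∫ u ^ (1 - δ)) ^ (1 / (1 - δ))) / (2 δ) ^ a`, and for `δ = 1 / (4 log K)` and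
`u ≤ K² ∫ u` that functional is at least `(δ/2) Ent u` (`Beckner.entropy_le_beckner`, which rests on
a scalar inequality). Hence `Ent u (1 + τ / (C' log^(1-a) K)) ≤ Ent f`
(`Beckner.entropy_resolventCLM_le`), with `C' = C 2^a 4^(1-a)`.

*Form domain.* The tests above need the closure of the graph of the gradient to be stable under
composition with smooth functions (`Beckner.exists_comp_mem_gradClosure`), to contain the constants
(`Beckner.const_one_mem_gradClosure`), and to satisfy the Beckner inequality
(`Beckner.GBI.of_mem_gradClosure`). Consequently the resolvent is Markovian and symmetric, so the
bounds and the mean of `f` survive each step. The logarithm is singular at `0`; constants are added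
to `f` first and removed at the end.

*Exponential formula.* The iterates converge because the resolvents are commuting contractions
satisfying the resolvent identity and `(1 - L)⁻²` has dense range
(`Beckner.ResolventIdentity.exists_tendsto_pow`).

*Truncation.* `Ent (h 1_{h ≤ K}) ≤ Ent h`, and `log K ≥ 4 Ent h` makes the mass of `h 1_{h ≤ K}` at
least `1/2` (`Beckner.IsBoundedDensity.entropy_indicator_le`), so `K` is at most `K²` times this
mass, as the one-step estimate requires.
-/

open MeasureTheory Filter Topology
open scoped ContDiff Gradient

namespace Beckner

/-! ### The exponential formula for a family of resolvents -/

section ExponentialFormula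

variable {H : Type*} [NormedAddCommGroup H] [NormedSpace ℝ H] {R : ℝ → H →L[ℝ] H}

/-- The resolvent identity `R_τ (σ u + τ (f - u)) = σ u`, `u = R_σ f`, for a family of operators
`R_τ` (which play the role of `(1 - τ L)⁻¹`). -/
def ResolventIdentity (R : ℝ → H →L[ℝ] H) : Prop :=
  ∀ σ τ : ℝ, 0 < σ → 0 < τ → ∀ f, R τ (σ • R σ f + τ • (f - R σ f)) = σ • R σ f

/-- The pair `(f, g)` belongs to the graph of the operator `-L` of the resolvent family
`R_τ = (1 - τ L)⁻¹`, expressed through the resolvents: `R_τ (f + τ g) = f` for all `τ > 0`. -/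
def InGenerator (R : ℝ → H →L[ℝ] H) (f g : H) : Prop :=
  ∀ τ : ℝ, 0 < τ → R τ (f + τ • g) = f

lemma ResolventIdentity.inGenerator (hR : ResolventIdentity R) (k : H) :
    InGenerator R (R 1 k) (k - R 1 k) := by
  intro τ hτ
  simpa using hR 1 τ one_pos hτ k

lemma ResolventIdentity.commute (hR : ResolventIdentity R) {σ τ : ℝ} (hσ : 0 < σ) (hτ : 0 < τ) :
    Commute (R σ) (R τ) := by
  rcases eq_or_ne σ τ with rfl | hne
  · exact Commute.refl _
  ext f
  have h1 := hR σ τ hσ hτ f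
  have h2 := hR τ σ hτ hσ f
  simp only [map_add, map_smul, map_sub] at h1 h2
  have h3 : (σ - τ) • (R τ (R σ f) - R σ (R τ f)) = 0 := by
    linear_combination (norm := module) h1 + h2
  rw [smul_eq_zero, sub_eq_zero, sub_eq_zero] at h3
  exact (h3.resolve_left hne).symm

variable (hc : ∀ τ, 0 < τ → ‖R τ‖ ≤ 1)

lemma norm_pow_apply_le {T : H →L[ℝ] H} (hT : ‖T‖ ≤ 1) (n : ℕ) (f : H) : ‖(T ^ n) f‖ ≤ ‖f‖ := by
  induction n with
  | zero => simp
  | succ n ih =>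
    rw [pow_succ']
    calc ‖T ((T ^ n) f)‖ ≤ ‖T‖ * ‖(T ^ n) f‖ := T.le_opNorm _
      _ ≤ 1 * ‖f‖ := by gcongr
      _ = ‖f‖ := one_mul _

lemma InGenerator.apply_eq {f g : H} (h : InGenerator R f g) {τ : ℝ} (hτ : 0 < τ) :
    R τ f = f - τ • R τ g := by
  have := h τ hτ
  rw [map_add, map_smul] at this
  exact eq_sub_of_add_eq this

include hc in
lemma InGenerator.norm_pow_sub_le {f g : H} (h : InGenerator R f g) {τ : ℝ} (hτ : 0 < τ) (n : ℕ) :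
    ‖(R τ ^ n) f - f‖ ≤ n * τ * ‖g‖ := by
  induction n with
  | zero => simp
  | succ n ih =>
    have : (R τ ^ (n + 1)) f - f = ((R τ ^ n) f - f) - τ • (R τ ^ (n + 1)) g := by
      rw [pow_succ, mul_apply_eq_comp, mul_apply_eq_comp, h.apply_eq hτ,
        map_sub, map_smul]
      abel
    rw [this]
    calc _ ≤ ‖(R τ ^ n) f - f‖ + ‖τ • (R τ ^ (n + 1)) g‖ := norm_sub_le _ _
      _ ≤ n * τ * ‖g‖ + τ * ‖g‖ := by
        rw [norm_smul, Real.norm_of_nonneg hτ.le]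
        gcongr
        exact norm_pow_apply_le (hc τ hτ) _ _
      _ = _ := by push_cast; ring

include hc in
/-- First-order expansion of `R_τ ^ n` on the domain of the square of the generator. -/
lemma InGenerator.norm_pow_sub_add_le {f g k : H} (h : InGenerator R f g)
    (h' : InGenerator R g k) {τ : ℝ} (hτ : 0 < τ) (n : ℕ) :
    ‖(R τ ^ n) f - f + (n * τ) • g‖ ≤ (n * τ) ^ 2 * ‖k‖ := by
  induction n with
  | zero => simp
  | succ n ih =>
    have : (R τ ^ (n + 1)) f - f + (((n + 1 : ℕ) : ℝ) * τ) • g =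
        ((R τ ^ n) f - f + (n * τ) • g) - τ • ((R τ ^ (n + 1)) g - g) := by
      rw [pow_succ, mul_apply_eq_comp, mul_apply_eq_comp, h.apply_eq hτ,
        map_sub, map_smul]
      push_cast
      module
    rw [this]
    calc _ ≤ ‖(R τ ^ n) f - f + (n * τ) • g‖ + ‖τ • ((R τ ^ (n + 1)) g - g)‖ := norm_sub_le _ _
      _ ≤ (n * τ) ^ 2 * ‖k‖ + τ * (((n + 1 : ℕ) : ℝ) * τ * ‖k‖) := by
        rw [norm_smul, Real.norm_of_nonneg hτ.le]
        gcongr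
        exact h'.norm_pow_sub_le hc hτ _
      _ ≤ _ := by
        have : 0 ≤ n * (τ ^ 2 * ‖k‖) := by positivity
        push_cast
        nlinarith

lemma norm_pow_sub_pow_apply_le {X Y : H →L[ℝ] H} (hXY : Commute X Y) (hX : ‖X‖ ≤ 1)
    (hY : ‖Y‖ ≤ 1) (n : ℕ) (f : H) : ‖(X ^ n) f - (Y ^ n) f‖ ≤ n * ‖X f - Y f‖ := by
  induction n with
  | zero => simp
  | succ n ih =>
    have : (X ^ (n + 1)) f - (Y ^ (n + 1)) f =
        (X ^ n) (X f - Y f) + Y ((X ^ n) f - (Y ^ n) f) := by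
      have h1 : (X ^ n) (Y f) = Y ((X ^ n) f) := DFunLike.congr_fun (hXY.pow_left n).eq f
      rw [map_sub, map_sub, h1, pow_succ, pow_succ']
      simp
    rw [this]
    calc _ ≤ ‖(X ^ n) (X f - Y f)‖ + ‖Y ((X ^ n) f - (Y ^ n) f)‖ := norm_add_le _ _
      _ ≤ ‖X f - Y f‖ + 1 * (n * ‖X f - Y f‖) := by
        gcongr
        · exact norm_pow_apply_le hX _ _
        · exact (Y.le_opNorm _).trans (by gcongr)
      _ = _ := by push_cast; ring

include hc in
/-- Refining the time step in the exponential formula costs `O(1 / n)` on the domain of the square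
of the generator: compare both products over a time `t / n` with the same first-order expansion. -/
lemma InGenerator.norm_pow_sub_pow_mul_le (hR : ResolventIdentity R) {f g k : H}
    (h : InGenerator R f g) (h' : InGenerator R g k) {t : ℝ} (ht : 0 < t) {n m : ℕ} (hn : 0 < n)
    (hm : 0 < m) :
    ‖(R (t / n) ^ n) f - (R (t / (n * m : ℕ)) ^ (n * m)) f‖ ≤ 2 * t ^ 2 * ‖k‖ / n := by
  have hn' : (0 : ℝ) < n := by exact_mod_cast hn
  have hm' : (0 : ℝ) < m := by exact_mod_cast hm
  have hτ : 0 < t / n := by positivity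
  have hσ : 0 < t / (n * m : ℕ) := by positivity
  have h1 := h.norm_pow_sub_add_le hc h' hτ 1
  have h2 := h.norm_pow_sub_add_le hc h' hσ m
  have e : (m : ℝ) * (t / (n * m : ℕ)) = t / n := by push_cast; field_simp
  rw [e] at h2
  simp only [Nat.cast_one, one_mul, pow_one] at h1
  have hY : ‖R (t / (n * m : ℕ)) ^ m‖ ≤ 1 :=
    ContinuousLinearMap.opNorm_le_bound _ zero_le_one fun x => by
      simpa using norm_pow_apply_le (hc _ hσ) m x
  have h3 := norm_pow_sub_pow_apply_le ((hR.commute hτ hσ).pow_right m) (hc _ hτ) hY n f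
  rw [← pow_mul, mul_comm m n] at h3
  refine h3.trans ?_
  have h4 : ‖(R (t / n)) f - (R (t / (n * m : ℕ)) ^ m) f‖ ≤ 2 * ((t / n) ^ 2 * ‖k‖) := by
    have : (R (t / n)) f - (R (t / (n * m : ℕ)) ^ m) f =
      ((R (t / n)) f - f + (t / n) • g) - ((R (t / (n * m : ℕ)) ^ m) f - f + (t / n) • g) := by
      abel
    rw [this]
    exact (norm_sub_le _ _).trans (by linarith)
  calc _ ≤ n * (2 * ((t / n) ^ 2 * ‖k‖)) := by gcongr
    _ = _ := by field_simp

include hc in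
/-- The exponential formula: for a family of contractions satisfying the resolvent identity, for
which the square of the generator is densely defined, the iterates `(1 - (t/n) L)⁻ⁿ f` converge. -/
theorem ResolventIdentity.exists_tendsto_pow [CompleteSpace H] (hR : ResolventIdentity R)
    (hd : DenseRange fun k => R 1 (R 1 k)) {t : ℝ} (ht : 0 < t) (f : H) :
    ∃ u, Tendsto (fun n : ℕ => (R (t / n) ^ n) f) atTop (𝓝 u) := by
  refine cauchySeq_tendsto_of_complete ?_
  rw [Metric.cauchySeq_iff']
  intro ε hε
  obtain ⟨k, hk⟩ := Metric.denseRange_iff.1 hd f (ε / 4) (by positivity)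
  set f₀ := R 1 (R 1 k) with hf₀
  have h1 : InGenerator R f₀ (R 1 (k - R 1 k)) := by
    have := hR.inGenerator (R 1 k)
    rwa [← map_sub] at this
  have h2 := hR.inGenerator (k - R 1 k)
  set B := ‖k - R 1 k - R 1 (k - R 1 k)‖ with hB
  obtain ⟨N, hN⟩ := exists_nat_gt (2 * t ^ 2 * B / (ε / 4))
  have key : ∀ n : ℕ, 0 < n → ‖(R (t / n) ^ n) f - (R (t / n) ^ n) f₀‖ < ε / 4 := by
    intro n hn
    rw [← map_sub]
    refine (norm_pow_apply_le (hc _ (by positivity)) _ _).trans_lt ?_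
    rwa [← dist_eq_norm]
  have hN0 : (0 : ℝ) < (N + 1 : ℕ) := by positivity
  refine ⟨N + 1, fun n hn => ?_⟩
  have hn0 : 0 < n := by omega
  have b1 := h1.norm_pow_sub_pow_mul_le hc hR h2 ht hn0 (Nat.succ_pos N)
  have b2 := h1.norm_pow_sub_pow_mul_le hc hR h2 ht (Nat.succ_pos N) hn0
  rw [mul_comm (N.succ) n] at b2
  have hb : 2 * t ^ 2 * B / (N + 1 : ℕ) ≤ ε / 4 := by
    rw [div_le_iff₀ hN0]
    rw [div_lt_iff₀ (by positivity)] at hN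
    push_cast
    nlinarith
  have hb' : 2 * t ^ 2 * B / n ≤ ε / 4 := by
    refine le_trans ?_ hb
    have : ((N + 1 : ℕ) : ℝ) ≤ n := by exact_mod_cast hn
    gcongr
  have a1 := key n hn0
  have a2 := key (N + 1) (Nat.succ_pos N)
  rw [dist_eq_norm]
  have : (R (t / n) ^ n) f - (R (t / (N + 1 : ℕ)) ^ (N + 1)) f =
      ((R (t / n) ^ n) f - (R (t / n) ^ n) f₀)
      + ((R (t / n) ^ n) f₀ - (R (t / (n * N.succ : ℕ)) ^ (n * N.succ)) f₀)
      - ((R (t / (N + 1 : ℕ)) ^ (N + 1)) f₀ - (R (t / (n * N.succ : ℕ)) ^ (n * N.succ)) f₀)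
      - ((R (t / (N + 1 : ℕ)) ^ (N + 1)) f - (R (t / (N + 1 : ℕ)) ^ (N + 1)) f₀) := by
    abel
  rw [this]
  refine (norm_sub_le _ _).trans_lt ?_
  have c1 := norm_sub_le (((R (t / n) ^ n) f - (R (t / n) ^ n) f₀)
      + ((R (t / n) ^ n) f₀ - (R (t / (n * N.succ : ℕ)) ^ (n * N.succ)) f₀))
      ((R (t / (N + 1 : ℕ)) ^ (N + 1)) f₀ - (R (t / (n * N.succ : ℕ)) ^ (n * N.succ)) f₀)
  have c2 := norm_add_le ((R (t / n) ^ n) f - (R (t / n) ^ n) f₀)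
      ((R (t / n) ^ n) f₀ - (R (t / (n * N.succ : ℕ)) ^ (n * N.succ)) f₀)
  have b2' := b2.trans hb
  have b1' := b1.trans hb'
  linarith

end ExponentialFormula


/-! ### The closure of the gradient -/

section Approximation

lemma tendsto_eLpNorm_two_of_dominated {X E : Type*} [MeasurableSpace X] {μ : Measure X}
    [NormedAddCommGroup E] {f : ℕ → X → E} {b : X → ℝ} (hb : MemLp b 2 μ)
    (hf : ∀ n, AEStronglyMeasurable (f n) μ) (hfb : ∀ n, ∀ᵐ x ∂μ, ‖f n x‖ ≤ b x)
    (hlim : ∀ᵐ x ∂μ, Tendsto (fun n => f n x) atTop (𝓝 0)) :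
    Tendsto (fun n => eLpNorm (f n) 2 μ) atTop (𝓝 0) := by
  simp_rw [eLpNorm_eq_lintegral_rpow_enorm_toReal (p := 2) (by simp) (by simp)]
  have h := tendsto_lintegral_of_dominated_convergence' (μ := μ)
    (F := fun n x => ‖f n x‖ₑ ^ (2 : ENNReal).toReal) (f := fun _ => 0)
    (fun x => ‖b x‖ₑ ^ (2 : ENNReal).toReal)
    (fun n => (hf n).enorm.pow_const _)
    (fun n => by
      filter_upwards [hfb n] with x hx
      have : ‖f n x‖ₑ ≤ ‖b x‖ₑ := by
        rw [enorm_le_iff_norm_le]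
        exact hx.trans (le_abs_self _)
      gcongr)
    ((eLpNorm_lt_top_iff_lintegral_rpow_enorm_lt_top (by simp) (by simp)).1 hb.2).ne
    (by
      filter_upwards [hlim] with x hx
      have h1 : Tendsto (fun n => ‖f n x‖ₑ) atTop (𝓝 0) := by
        simpa [Function.comp_def] using (continuous_enorm.tendsto (0 : E)).comp hx
      simpa using h1.ennrpow_const (2 : ENNReal).toReal)
  simpa using h.ennrpow_const (1 / (2 : ENNReal).toReal)

variable {ι : Type} [Fintype ι]

lemma gradient_comp {ψ : ℝ → ℝ} {φ : EuclideanSpace ℝ ι → ℝ} (hψ : Differentiable ℝ ψ)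
    (hφ : Differentiable ℝ φ) (x : EuclideanSpace ℝ ι) :
    ∇ (fun y => ψ (φ y)) x = deriv ψ (φ x) • ∇ φ x := by
  refine HasGradientAt.gradient ?_
  rw [hasGradientAt_iff_hasFDerivAt, map_smul, toDual_gradient]
  exact (hψ (φ x)).hasDerivAt.comp_hasFDerivAt x (hφ x).hasFDerivAt

lemma continuous_gradient {φ : EuclideanSpace ℝ ι → ℝ} (hφ : ContDiff ℝ 1 φ) :
    Continuous (∇ φ) :=
  (InnerProductSpace.toDual ℝ _).symm.continuous.comp (hφ.continuous_fderiv (by simp))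

lemma hasCompactSupport_gradient {φ : EuclideanSpace ℝ ι → ℝ} (hφ : HasCompactSupport φ) :
    HasCompactSupport (∇ φ) :=
  (hφ.fderiv ℝ).comp_left (g := (InnerProductSpace.toDual ℝ _).symm) (map_zero _)

/-- The closure of the graph of `c ∇` on smooth compactly supported functions. -/
noncomputable abbrev gradClosure (μ : Measure (EuclideanSpace ℝ ι)) (c : ℝ) :
    Submodule ℝ (WithLp 2 (Lp ℝ 2 μ × Lp (EuclideanSpace ℝ ι) 2 μ)) :=
  (gradGraph μ c).topologicalClosure

variable {μ : Measure (EuclideanSpace ℝ ι)} {c : ℝ}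
  {w : WithLp 2 (Lp ℝ 2 μ × Lp (EuclideanSpace ℝ ι) 2 μ)}

lemma exists_approx (hw : w ∈ gradClosure μ c) :
    ∃ φ : ℕ → EuclideanSpace ℝ ι → ℝ, (∀ k, ContDiff ℝ ∞ (φ k)) ∧ (∀ k, HasCompactSupport (φ k)) ∧
      Tendsto (fun k => eLpNorm (fun x => φ k x - w.fst x) 2 μ) atTop (𝓝 0) ∧
      Tendsto (fun k => eLpNorm (fun x => c • ∇ (φ k) x - w.snd x) 2 μ) atTop (𝓝 0) ∧
      ∀ᵐ x ∂μ, Tendsto (fun k => φ k x) atTop (𝓝 (w.fst x)) := by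
  obtain ⟨v, hv, hlim⟩ := mem_closure_iff_seq_limit.1 hw
  choose φ hφ hφc h1 h2 using hv
  have l1 : Tendsto (fun k => (v k).fst) atTop (𝓝 w.fst) :=
    ((WithLp.continuous_fst 2 _ _).tendsto w).comp hlim
  have l2 : Tendsto (fun k => (v k).snd) atTop (𝓝 w.snd) :=
    ((WithLp.continuous_snd 2 _ _).tendsto w).comp hlim
  obtain ⟨ns, hns, hae⟩ := (tendstoInMeasure_of_tendsto_Lp l1).exists_seq_tendsto_ae
  rw [Lp.tendsto_Lp_iff_tendsto_eLpNorm'] at l1 l2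
  refine ⟨fun k => φ (ns k), fun k => hφ _, fun k => hφc _, ?_, ?_, ?_⟩
  · refine (l1.comp hns.tendsto_atTop).congr fun k => eLpNorm_congr_ae ?_
    exact (h1 (ns k)).sub (ae_eq_refl _)
  · refine (l2.comp hns.tendsto_atTop).congr fun k => eLpNorm_congr_ae ?_
    exact (h2 (ns k)).sub (ae_eq_refl _)
  · filter_upwards [hae, ae_all_iff.2 h1] with x hx hx1
    exact hx.congr fun k => hx1 (ns k)

lemma mem_gradClosure_of_tendsto [IsFiniteMeasure μ] {φ : ℕ → EuclideanSpace ℝ ι → ℝ}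
    (hφ : ∀ k, ContDiff ℝ ∞ (φ k)) (hφc : ∀ k, HasCompactSupport (φ k))
    (h1 : Tendsto (fun k => eLpNorm (fun x => φ k x - w.fst x) 2 μ) atTop (𝓝 0))
    (h2 : Tendsto (fun k => eLpNorm (fun x => c • ∇ (φ k) x - w.snd x) 2 μ) atTop (𝓝 0)) :
    w ∈ gradClosure μ c := by
  have m1 : ∀ k, MemLp (φ k) 2 μ := fun k =>
    (hφ k).continuous.memLp_of_hasCompactSupport (hφc k)
  have m2 : ∀ k, MemLp (fun x => c • ∇ (φ k) x) 2 μ := fun k =>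
    ((continuous_gradient ((hφ k).of_le (by simp))).memLp_of_hasCompactSupport
      (hasCompactSupport_gradient (hφc k))).const_smul c
  refine mem_closure_iff_seq_limit.2
    ⟨fun k => WithLp.toLp 2 ((m1 k).toLp, (m2 k).toLp), fun k => ?_, ?_⟩
  · exact ⟨φ k, hφ k, hφc k, (m1 k).coeFn_toLp, (m2 k).coeFn_toLp⟩
  · have l1 : Tendsto (fun k => (m1 k).toLp) atTop (𝓝 w.fst) := by
      rw [Lp.tendsto_Lp_iff_tendsto_eLpNorm']
      exact h1.congr fun k => eLpNorm_congr_ae ((m1 k).coeFn_toLp.symm.sub (ae_eq_refl _))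
    have l2 : Tendsto (fun k => (m2 k).toLp) atTop (𝓝 w.snd) := by
      rw [Lp.tendsto_Lp_iff_tendsto_eLpNorm']
      exact h2.congr fun k => eLpNorm_congr_ae ((m2 k).coeFn_toLp.symm.sub (ae_eq_refl _))
    exact ((WithLp.prod_continuous_toLp 2 _ _).tendsto (w.fst, w.snd)).comp (l1.prodMk_nhds l2)

/-- Chain rule in the closure of the gradient. No closability is needed: along approximating smooth
functions `φ_k`, the products `ψ'(φ_k) ∇φ_k` converge in `L²`. -/
lemma exists_comp_mem_gradClosure [IsFiniteMeasure μ] (hw : w ∈ gradClosure μ c) {ψ : ℝ → ℝ}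
    (hψ : ContDiff ℝ ∞ ψ) (hψ0 : ψ 0 = 0) {M : ℝ} (hM : ∀ s, |deriv ψ s| ≤ M) :
    ∃ v ∈ gradClosure μ c, v.fst =ᵐ[μ] (fun x => ψ (w.fst x)) ∧
      v.snd =ᵐ[μ] fun x => deriv ψ (w.fst x) • w.snd x := by
  obtain ⟨φ, hφ, hφc, h1, h2, h3⟩ := exists_approx hw
  have hM0 : 0 ≤ M := (abs_nonneg _).trans (hM 0)
  have hd : Differentiable ℝ ψ := hψ.differentiable (by simp)
  have hdc : Continuous (deriv ψ) := hψ.continuous_deriv (by simp)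
  have lip : ∀ s r, |ψ s - ψ r| ≤ M * |s - r| := fun s r => by
    have := Convex.norm_image_sub_le_of_norm_deriv_le (f := ψ) (s := Set.univ) (C := M)
      (fun x _ => hd x) (fun x _ => hM x) convex_univ (Set.mem_univ r) (Set.mem_univ s)
    simpa using this
  have sm1 : AEStronglyMeasurable (fun x => ψ (w.fst x)) μ :=
    hψ.continuous.comp_aestronglyMeasurable (Lp.aestronglyMeasurable _)
  have sm2 : AEStronglyMeasurable (fun x => deriv ψ (w.fst x) • w.snd x) μ :=
    (hdc.comp_aestronglyMeasurable (Lp.aestronglyMeasurable _)).smul (Lp.aestronglyMeasurable _)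
  have m1 : MemLp (fun x => ψ (w.fst x)) 2 μ :=
    (Lp.memLp w.fst).of_le_mul (c := M) sm1 (ae_of_all _ fun x => by
      simpa [hψ0] using lip (w.fst x) 0)
  have m2 : MemLp (fun x => deriv ψ (w.fst x) • w.snd x) 2 μ :=
    (Lp.memLp w.snd).of_le_mul (c := M) sm2 (ae_of_all _ fun x => by
      rw [norm_smul]
      gcongr
      exact hM _)
  refine ⟨WithLp.toLp 2 (m1.toLp, m2.toLp), ?_, m1.coeFn_toLp, m2.coeFn_toLp⟩
  refine mem_gradClosure_of_tendsto (φ := fun k x => ψ (φ k x)) (fun k => hψ.comp (hφ k))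
    (fun k => (hφc k).comp_left (g := ψ) hψ0) ?_ ?_
  · have l : Tendsto (fun k => ENNReal.ofReal M *
        eLpNorm (fun x => φ k x - w.fst x) 2 μ) atTop (𝓝 0) := by
      simpa using ENNReal.Tendsto.const_mul h1 (Or.inr ENNReal.ofReal_ne_top)
    refine tendsto_of_tendsto_of_tendsto_of_le_of_le tendsto_const_nhds l (fun _ => zero_le) ?_
    intro k
    refine eLpNorm_le_mul_eLpNorm_of_ae_le_mul ?_ 2
    filter_upwards [m1.coeFn_toLp] with x hx
    simp only [WithLp.toLp_fst, hx]
    exact lip _ _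
  · have l : Tendsto (fun k => ENNReal.ofReal M *
        eLpNorm (fun x => c • ∇ (φ k) x - w.snd x) 2 μ) atTop (𝓝 0) := by
      simpa using ENNReal.Tendsto.const_mul h2 (Or.inr ENNReal.ofReal_ne_top)
    have smk : ∀ k, AEStronglyMeasurable
        (fun x => (deriv ψ (φ k x) - deriv ψ (w.fst x)) • w.snd x) μ := fun k =>
      ((hdc.comp_aestronglyMeasurable (hφ k).continuous.aestronglyMeasurable).sub
        (hdc.comp_aestronglyMeasurable (Lp.aestronglyMeasurable _))).smul
          (Lp.aestronglyMeasurable _)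
    have l' : Tendsto (fun k => eLpNorm
        (fun x => (deriv ψ (φ k x) - deriv ψ (w.fst x)) • w.snd x) 2 μ) atTop (𝓝 0) := by
      refine tendsto_eLpNorm_two_of_dominated (b := fun x => 2 * M * ‖w.snd x‖)
        ((Lp.memLp w.snd).norm.const_mul _) smk ?_ ?_
      · refine fun k => ae_of_all _ fun x => ?_
        rw [norm_smul]
        gcongr
        refine (norm_sub_le _ _).trans ?_
        have b1 : ‖deriv ψ (φ k x)‖ ≤ M := hM _
        have b2 : ‖deriv ψ (w.fst x)‖ ≤ M := hM _
        linarith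
      · filter_upwards [h3] with x hx
        have : Tendsto (fun k => deriv ψ (φ k x) - deriv ψ (w.fst x)) atTop (𝓝 0) := by
          simpa using ((hdc.tendsto _).comp hx).sub_const (deriv ψ (w.fst x))
        simpa using this.smul_const (w.snd x)
    have l'' := l.add l'
    rw [add_zero] at l''
    refine tendsto_of_tendsto_of_tendsto_of_le_of_le tendsto_const_nhds l'' (fun _ => zero_le) ?_
    intro k
    have sm3 : AEStronglyMeasurable (fun x => c • ∇ (φ k) x - w.snd x) μ :=
      ((continuous_gradient ((hφ k).of_le (by simp))).const_smul c).aestronglyMeasurable.sub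
        (Lp.aestronglyMeasurable _)
    have e : (fun x => c • ∇ (fun y => ψ (φ k y)) x - (m2.toLp _) x) =ᵐ[μ]
        (fun x => deriv ψ (φ k x) • (c • ∇ (φ k) x - w.snd x)) +
        (fun x => (deriv ψ (φ k x) - deriv ψ (w.fst x)) • w.snd x) := by
      filter_upwards [m2.coeFn_toLp] with x hx
      simp only [Pi.add_apply, hx]
      rw [gradient_comp hd ((hφ k).differentiable (by simp))]
      module
    refine (eLpNorm_congr_ae e).trans_le ?_
    refine (eLpNorm_add_le ?_ (smk k) (by norm_num)).trans ?_
    · exact (hdc.comp_aestronglyMeasurable (hφ k).continuous.aestronglyMeasurable).smul sm3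
    · refine add_le_add ?_ le_rfl
      refine eLpNorm_le_mul_eLpNorm_of_ae_le_mul (ae_of_all _ fun x => ?_) 2
      rw [norm_smul]
      gcongr
      exact hM _

/-- Constants belong to the domain of the closed form: the cutoffs `χ(x / k)` have gradients of
size `O(1 / k)`. -/
lemma const_one_mem_gradClosure [IsFiniteMeasure μ] (c : ℝ) :
    WithLp.toLp 2 ((memLp_const (1 : ℝ)).toLp, 0) ∈ gradClosure μ c := by
  let χ : ContDiffBump (0 : EuclideanSpace ℝ ι) := ⟨1, 2, one_pos, one_lt_two⟩
  have hχ : ContDiff ℝ ∞ χ := χ.contDiff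
  obtain ⟨B, hB⟩ := (hasCompactSupport_gradient χ.hasCompactSupport).exists_bound_of_continuous
    (continuous_gradient (hχ.of_le (by simp)))
  have hB0 : 0 ≤ B := (norm_nonneg _).trans (hB 0)
  let s : ℕ → ℝ := fun k => ((k : ℝ) + 1)⁻¹
  have hs : ∀ k, 0 < s k := fun k => by positivity
  have hsl : Tendsto s atTop (𝓝 0) := by
    simpa [s, one_div] using tendsto_one_div_add_atTop_nhds_zero_nat (𝕜 := ℝ)
  have hφ : ∀ k, ContDiff ℝ ∞ fun x : EuclideanSpace ℝ ι => χ (s k • x) := fun k =>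
    hχ.comp (contDiff_const_smul (s k))
  have hg : ∀ k x, ∇ (fun x : EuclideanSpace ℝ ι => χ (s k • x)) x = s k • ∇ χ (s k • x) := by
    intro k x
    refine HasGradientAt.gradient ?_
    rw [hasGradientAt_iff_hasFDerivAt, map_smul, toDual_gradient]
    have h1 : HasFDerivAt (fun x : EuclideanSpace ℝ ι => s k • x)
      (s k • ContinuousLinearMap.id ℝ _) x := (hasFDerivAt_id x).const_smul (s k)
    have := (hχ.differentiable (by simp) (s k • x)).hasFDerivAt.comp x h1
    refine this.congr_fderiv ?_
    ext y
    simp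
  refine mem_gradClosure_of_tendsto (φ := fun k x => χ (s k • x)) hφ
    (fun k => χ.hasCompactSupport.comp_smul (hs k).ne') ?_ ?_
  · have : Tendsto (fun k => eLpNorm (fun x => χ (s k • x) - 1) 2 μ) atTop (𝓝 0) := by
      refine tendsto_eLpNorm_two_of_dominated (memLp_const (1 : ℝ))
        (fun k => ((hφ k).continuous.sub continuous_const).aestronglyMeasurable) ?_ ?_
      · refine fun k => ae_of_all _ fun x => ?_
        rw [Real.norm_eq_abs, abs_le]
        constructor <;> linarith [χ.nonneg' (s k • x), χ.le_one (x := s k • x)]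
      · refine ae_of_all _ fun x => ?_
        have h1 : Tendsto (fun k => s k • x) atTop (𝓝 0) := by simpa using hsl.smul_const x
        have h2 : χ 0 = 1 := χ.one_of_mem_closedBall (by simp [χ])
        have := (((hχ.continuous.tendsto 0).comp h1).sub_const 1)
        simpa [h2] using this
    refine this.congr fun k => eLpNorm_congr_ae ?_
    filter_upwards [(memLp_const (μ := μ) (p := 2) (1 : ℝ)).coeFn_toLp] with x hx
    rw [WithLp.toLp_fst, hx]
  · refine tendsto_eLpNorm_two_of_dominated (memLp_const (|c| * B)) (fun k => ?_) ?_ ?_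
    · exact ((continuous_gradient ((hφ k).of_le (by simp))).const_smul c).aestronglyMeasurable.sub
        (Lp.aestronglyMeasurable _)
    · intro k
      filter_upwards [Lp.coeFn_zero (EuclideanSpace ℝ ι) 2 μ] with x hx
      simp only [WithLp.toLp_snd, hx, hg, Pi.zero_apply, sub_zero, norm_smul,
        Real.norm_eq_abs]
      have : |s k| ≤ 1 := by
        rw [abs_of_pos (hs k)]
        exact inv_le_one_of_one_le₀ (by simp)
      calc _ ≤ |c| * (1 * B) := by gcongr; exact hB _
        _ = _ := by ring
    · filter_upwards [Lp.coeFn_zero (EuclideanSpace ℝ ι) 2 μ] with x hx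
      simp only [WithLp.toLp_snd, hx, hg, Pi.zero_apply, sub_zero]
      have h1 : Tendsto (fun k => |c| * (|s k| * B)) atTop (𝓝 0) := by
        simpa using (hsl.abs.mul_const B).const_mul |c|
      refine squeeze_zero_norm (fun k => ?_) h1
      simp only [norm_smul, Real.norm_eq_abs]
      gcongr
      exact hB _

/-- Changing the scale of the gradient. -/
lemma smul_snd_mem_gradClosure (hw : w ∈ gradClosure μ c) (r : ℝ) :
    WithLp.toLp 2 (w.fst, r • w.snd) ∈ gradClosure μ (r * c) := by
  have hcont : Continuous fun w : WithLp 2 (Lp ℝ 2 μ × Lp (EuclideanSpace ℝ ι) 2 μ) =>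
      WithLp.toLp 2 (w.fst, r • w.snd) :=
    (WithLp.prod_continuous_toLp 2 _ _).comp
      ((WithLp.continuous_fst 2 _ _).prodMk ((WithLp.continuous_snd 2 _ _).const_smul r))
  refine map_mem_closure (f := fun w : WithLp 2 (Lp ℝ 2 μ × Lp (EuclideanSpace ℝ ι) 2 μ) =>
    WithLp.toLp 2 (w.fst, r • w.snd)) hcont hw ?_
  rintro v ⟨φ, hφ, hφc, h1, h2⟩
  refine ⟨φ, hφ, hφc, h1, ?_⟩
  filter_upwards [Lp.coeFn_smul r v.snd, h2] with x hx hx2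
  simp [hx, hx2, mul_smul]

/-- The generalized Beckner inequality on the closure of the gradient. -/
lemma GBI.of_mem_gradClosure [IsProbabilityMeasure μ] {a C : ℝ} (h : GBI μ a C)
    (hw : w ∈ gradClosure μ c) {p : ℝ} (hp1 : 1 < p) (hp2 : p < 2) :
    c ^ 2 * (∫ x, w.fst x ^ 2 ∂μ - (∫ x, |w.fst x| ^ p ∂μ) ^ (2 / p))
      ≤ C * (2 - p) ^ a * ∫ x, ‖w.snd x‖ ^ 2 ∂μ := by
  have hp0 : 0 < p := by linarith
  set q : ENNReal := ENNReal.ofReal p with hq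
  have hq0 : q ≠ 0 := by simp [hq, hp0]
  have hqt : q ≠ ⊤ := ENNReal.ofReal_ne_top
  have hqr : q.toReal = p := ENNReal.toReal_ofReal hp0.le
  have hq1 : 1 ≤ q := by rw [hq]; exact ENNReal.one_le_ofReal.2 hp1.le
  have hq2 : q ≤ 2 := by rw [hq, ← ENNReal.ofReal_ofNat 2]; exact ENNReal.ofReal_le_ofReal hp2.le
  -- the three integrals, as continuous functions on `L²`
  have e1 : ∀ f : Lp ℝ 2 μ, ∫ x, f x ^ 2 ∂μ = ‖f‖ ^ 2 := fun f => by
    rw [← real_inner_self_eq_norm_sq, L2.inner_def]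
    simp [sq]
  have e2 : ∀ f : Lp (EuclideanSpace ℝ ι) 2 μ, ∫ x, ‖f x‖ ^ 2 ∂μ = ‖f‖ ^ 2 := fun f => by
    rw [← real_inner_self_eq_norm_sq, L2.inner_def]
    simp
  have mq : ∀ f : Lp ℝ 2 μ, MemLp f q μ := fun f => (Lp.memLp f).mono_exponent hq2
  have e3 : ∀ f : Lp ℝ 2 μ, (∫ x, |f x| ^ p ∂μ) ^ (2 / p) = (eLpNorm f q μ).toReal ^ 2 := by
    intro f
    have h0 : 0 ≤ ∫ x, |f x| ^ p ∂μ := integral_nonneg fun x => by positivity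
    rw [(mq f).eLpNorm_eq_integral_rpow_norm hq0 hqt, hqr]
    simp only [Real.norm_eq_abs]
    rw [ENNReal.toReal_ofReal (by positivity), ← Real.rpow_natCast, ← Real.rpow_mul h0]
    congr 1
    push_cast
    ring
  have lip : LipschitzWith 1 fun f : Lp ℝ 2 μ => (eLpNorm f q μ).toReal := by
    refine LipschitzWith.of_le_add_mul 1 fun f g => ?_
    have h1 : eLpNorm f q μ ≤ eLpNorm g q μ + eLpNorm (f - g : Lp ℝ 2 μ) 2 μ := by
      have : f =ᵐ[μ] (fun x => g x) + fun x => (f - g : Lp ℝ 2 μ) x := by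
        filter_upwards [Lp.coeFn_sub f g] with x hx
        rw [Pi.add_apply, hx, Pi.sub_apply]
        ring
      rw [eLpNorm_congr_ae this]
      refine (eLpNorm_add_le (Lp.aestronglyMeasurable _) (Lp.aestronglyMeasurable _) hq1).trans ?_
      gcongr
      exact eLpNorm_le_eLpNorm_of_exponent_le hq2 (Lp.aestronglyMeasurable _)
    have h2 := ENNReal.toReal_mono
      (ENNReal.add_ne_top.2 ⟨(mq g).2.ne, Lp.eLpNorm_ne_top _⟩) h1
    rw [ENNReal.toReal_add (mq g).2.ne (Lp.eLpNorm_ne_top _), ← Lp.norm_def] at h2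
    simpa [dist_eq_norm] using h2
  rw [e1, e2, e3]
  have hclosed : IsClosed {v : WithLp 2 (Lp ℝ 2 μ × Lp (EuclideanSpace ℝ ι) 2 μ) |
      c ^ 2 * (‖v.fst‖ ^ 2 - (eLpNorm v.fst q μ).toReal ^ 2) ≤
        C * (2 - p) ^ a * ‖v.snd‖ ^ 2} := by
    have c1 := WithLp.continuous_fst 2 (Lp ℝ 2 μ) (Lp (EuclideanSpace ℝ ι) 2 μ)
    have c2 := WithLp.continuous_snd 2 (Lp ℝ 2 μ) (Lp (EuclideanSpace ℝ ι) 2 μ)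
    exact isClosed_le (continuous_const.mul ((c1.norm.pow 2).sub
      ((lip.continuous.comp c1).pow 2))) (continuous_const.mul (c2.norm.pow 2))
  refine closure_minimal ?_ hclosed hw
  rintro v ⟨φ, hφ, hφc, h1, h2⟩
  have m1 : MemLp φ 2 μ := hφ.continuous.memLp_of_hasCompactSupport hφc
  have m2 : MemLp (∇ φ) 2 μ := (continuous_gradient (hφ.of_le (by simp))).memLp_of_hasCompactSupport
      (hasCompactSupport_gradient hφc)
  have key := h φ (hφ.of_le (by simp)) m1 m2 p hp1 hp2
  have hpos : 0 < (2 - p) ^ a := Real.rpow_pos_of_pos (by linarith) _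
  rw [div_le_iff₀ hpos] at key
  simp only [Set.mem_ofPred_eq]
  rw [← e1, ← e2, ← e3]
  have i1 : ∫ x, v.fst x ^ 2 ∂μ = ∫ x, φ x ^ 2 ∂μ :=
    integral_congr_ae (by filter_upwards [h1] with x hx; rw [hx])
  have i2 : ∫ x, |v.fst x| ^ p ∂μ = ∫ x, |φ x| ^ p ∂μ :=
    integral_congr_ae (by filter_upwards [h1] with x hx; rw [hx])
  have i3 : ∫ x, ‖v.snd x‖ ^ 2 ∂μ = c ^ 2 * ∫ x, ‖∇ φ x‖ ^ 2 ∂μ := by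
    rw [← integral_const_mul]
    refine integral_congr_ae ?_
    filter_upwards [h2] with x hx
    rw [hx, norm_smul, mul_pow, Real.norm_eq_abs, sq_abs]
  rw [i1, i2, i3]
  calc _ ≤ c ^ 2 * (C * (∫ x, ‖∇ φ x‖ ^ 2 ∂μ) * (2 - p) ^ a) := by gcongr
    _ = _ := by ring

end Approximation


/-! ### The resolvent of the Dirichlet form -/

section Resolvent

variable {ι : Type} [Fintype ι]

/-- The resolvent as a continuous linear map. -/
noncomputable def resolventCLM (μ : Measure (EuclideanSpace ℝ ι)) (τ : ℝ) :
    Lp ℝ 2 μ →L[ℝ] Lp ℝ 2 μ :=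
  WithLp.fstL 2 ℝ (Lp ℝ 2 μ) (Lp (EuclideanSpace ℝ ι) 2 μ) ∘L
    (gradClosure μ (Real.sqrt (τ / 2))).starProjection ∘L
    ((WithLp.prodContinuousLinearEquiv 2 ℝ (Lp ℝ 2 μ)
      (Lp (EuclideanSpace ℝ ι) 2 μ)).symm : _ →L[ℝ] _) ∘L
    ContinuousLinearMap.inl ℝ (Lp ℝ 2 μ) (Lp (EuclideanSpace ℝ ι) 2 μ)

variable {μ : Measure (EuclideanSpace ℝ ι)}

/-- The weak formulation of the resolvent equation `u - τ L u = f`: here `w` is `√(τ/2) ∇u`. -/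
lemma exists_resolvent_weak (τ : ℝ) (f : Lp ℝ 2 μ) :
    ∃ w, WithLp.toLp 2 (resolventCLM μ τ f, w) ∈ gradClosure μ (Real.sqrt (τ / 2)) ∧
      ∀ v ∈ gradClosure μ (Real.sqrt (τ / 2)),
        inner ℝ (f - resolventCLM μ τ f) v.fst = inner ℝ w v.snd := by
  set S := gradClosure μ (Real.sqrt (τ / 2))
  set P := S.starProjection (WithLp.toLp 2 (f, 0)) with hP
  have hu : resolventCLM μ τ f = P.fst := rfl
  refine ⟨P.snd, ?_, fun v hv => ?_⟩
  · exact S.starProjection_apply_mem _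
  · have := Submodule.starProjection_inner_eq_zero (K := S) (WithLp.toLp 2 (f, 0)) v hv
    rw [WithLp.prod_inner_apply] at this
    have h2 : inner ℝ (f - P.fst) v.fst + inner ℝ (0 - P.snd) v.snd = 0 := this
    rw [zero_sub, inner_neg_left] at h2
    rw [hu]
    linarith

lemma resolventCLM_eq {τ : ℝ} {f u : Lp ℝ 2 μ} {w : Lp (EuclideanSpace ℝ ι) 2 μ}
    (hu : WithLp.toLp 2 (u, w) ∈ gradClosure μ (Real.sqrt (τ / 2)))
    (h : ∀ v ∈ gradClosure μ (Real.sqrt (τ / 2)), inner ℝ (f - u) v.fst = inner ℝ w v.snd) :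
    resolventCLM μ τ f = u := by
  have : (gradClosure μ (Real.sqrt (τ / 2))).starProjection (WithLp.toLp 2 (f, 0)) =
      WithLp.toLp 2 (u, w) := by
    refine Submodule.eq_starProjection_of_mem_of_inner_eq_zero hu fun v hv => ?_
    rw [WithLp.prod_inner_apply]
    change inner ℝ (f - u) v.fst + inner ℝ (0 - w) v.snd = 0
    rw [zero_sub, inner_neg_left, h v hv, add_neg_cancel]
  exact congrArg WithLp.fst this

lemma norm_resolventCLM_le (τ : ℝ) : ‖resolventCLM μ τ‖ ≤ 1 := by
  refine ContinuousLinearMap.opNorm_le_bound _ zero_le_one fun f => ?_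
  set S := gradClosure μ (Real.sqrt (τ / 2))
  calc ‖resolventCLM μ τ f‖ ≤ ‖S.starProjection (WithLp.toLp 2 (f, 0))‖ := WithLp.norm_fst_le _ _
    _ ≤ ‖WithLp.toLp 2 (f, (0 : Lp (EuclideanSpace ℝ ι) 2 μ))‖ := S.norm_starProjection_apply_le _
    _ = 1 * ‖f‖ := by rw [WithLp.norm_toLp_fst, one_mul]

lemma inner_resolventCLM (τ : ℝ) (f g : Lp ℝ 2 μ) :
    inner ℝ (resolventCLM μ τ f) g = inner ℝ f (resolventCLM μ τ g) := by
  have := Submodule.inner_starProjection_left_eq_right (gradClosure μ (Real.sqrt (τ / 2)))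
    (WithLp.toLp 2 (f, 0)) (WithLp.toLp 2 (g, 0))
  rw [WithLp.prod_inner_apply, WithLp.prod_inner_apply] at this
  change inner ℝ (resolventCLM μ τ f) g + inner ℝ _ 0 =
    inner ℝ f (resolventCLM μ τ g) + inner ℝ 0 _ at this
  rwa [inner_zero_left, inner_zero_right, add_zero, add_zero] at this

lemma resolventIdentity_resolventCLM : ResolventIdentity (resolventCLM μ) := by
  intro σ τ hσ hτ f
  obtain ⟨w, hw, h⟩ := exists_resolvent_weak σ f
  set u := resolventCLM μ σ f
  -- `r` converts `√(σ/2) ∇` into `√(τ/2) ∇`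
  set r := Real.sqrt (τ / 2) / Real.sqrt (σ / 2) with hr
  have hs : 0 < Real.sqrt (σ / 2) := Real.sqrt_pos.2 (by positivity)
  have ht : 0 < Real.sqrt (τ / 2) := Real.sqrt_pos.2 (by positivity)
  have hr0 : 0 < r := div_pos ht hs
  have hr1 : r * Real.sqrt (σ / 2) = Real.sqrt (τ / 2) := div_mul_cancel₀ _ hs.ne'
  have hr2 : r ^ 2 * σ = τ := by
    rw [hr, div_pow, Real.sq_sqrt (by positivity), Real.sq_sqrt (by positivity)]
    field_simp
  have hu := smul_snd_mem_gradClosure hw r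
  rw [hr1] at hu
  refine resolventCLM_eq (w := (σ * r) • w) ?_ fun v hv => ?_
  · have := Submodule.smul_mem _ σ hu
    rw [mul_smul]
    exact this
  · have hv' := smul_snd_mem_gradClosure hv r⁻¹
    rw [← hr1, inv_mul_cancel_left₀ hr0.ne'] at hv'
    have := h _ hv'
    simp only [WithLp.toLp_fst, WithLp.toLp_snd, inner_smul_right] at this
    rw [add_sub_cancel_left, inner_smul_left, inner_smul_left, this, ← hr2]
    simp only [conj_trivial]
    field_simp

section Dense

variable [IsFiniteMeasure μ]

lemma toLp_mem_gradClosure {φ : EuclideanSpace ℝ ι → ℝ} (hφ : ContDiff ℝ ∞ φ)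
    (hφc : HasCompactSupport φ) (c : ℝ) :
    ∃ v ∈ gradClosure μ c, v.fst =ᵐ[μ] φ := by
  have m1 : MemLp φ 2 μ := hφ.continuous.memLp_of_hasCompactSupport hφc
  have m2 : MemLp (fun x => c • ∇ φ x) 2 μ :=
    ((continuous_gradient (hφ.of_le (by simp))).memLp_of_hasCompactSupport
      (hasCompactSupport_gradient hφc)).const_smul c
  exact ⟨WithLp.toLp 2 (m1.toLp, m2.toLp),
    subset_closure ⟨φ, hφ, hφc, m1.coeFn_toLp, m2.coeFn_toLp⟩, m1.coeFn_toLp⟩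

lemma eq_zero_of_inner_fst_eq_zero {f : Lp ℝ 2 μ} {c : ℝ}
    (h : ∀ v ∈ gradClosure μ c, inner ℝ f v.fst = 0) : f = 0 := by
  rw [Lp.eq_zero_iff_ae_eq_zero]
  refine ae_eq_zero_of_integral_contDiff_smul_eq_zero
    (((Lp.memLp f).integrable (by norm_num)).locallyIntegrable) fun φ hφ hφc => ?_
  obtain ⟨v, hv, hvφ⟩ := toLp_mem_gradClosure (μ := μ) hφ hφc c
  rw [← h v hv, L2.inner_def]
  refine integral_congr_ae ?_
  filter_upwards [hvφ] with x hx
  simp [hx]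

/-- For `τ = 0` the projection is onto `L²(μ) × {0}`, by density of the test functions. -/
lemma resolventCLM_zero (f : Lp ℝ 2 μ) : resolventCLM μ 0 f = f := by
  obtain ⟨w, hw, h⟩ := exists_resolvent_weak 0 f
  have hz : ∀ v ∈ gradClosure μ (Real.sqrt (0 / 2)), v.snd = 0 := by
    intro v hv
    have hcl : IsClosed {v : WithLp 2 (Lp ℝ 2 μ × Lp (EuclideanSpace ℝ ι) 2 μ) | v.snd = 0} :=
      isClosed_eq (WithLp.continuous_snd 2 _ _) continuous_const
    refine closure_minimal ?_ hcl hv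
    rintro v ⟨φ, -, -, -, h2⟩
    rw [Set.mem_ofPred_eq, Lp.eq_zero_iff_ae_eq_zero]
    filter_upwards [h2] with x hx
    simpa using hx
  have : f - resolventCLM μ 0 f = 0 := eq_zero_of_inner_fst_eq_zero fun v hv => by
    rw [h v hv, hz v hv, inner_zero_right]
  exact (sub_eq_zero.1 this).symm

/-- Injectivity of the resolvent. If `u = 0` then the gradient component `w` of the projection pairs
to zero with itself, so closability of the gradient plays no role. -/
lemma resolventCLM_injective (τ : ℝ) {f : Lp ℝ 2 μ} (hf : resolventCLM μ τ f = 0) : f = 0 := by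
  obtain ⟨w, hw, h⟩ := exists_resolvent_weak τ f
  rw [hf] at hw h
  have hw0 : w = 0 := by
    have := h _ hw
    simpa using this.symm
  refine eq_zero_of_inner_fst_eq_zero (c := Real.sqrt (τ / 2)) fun v hv => ?_
  simpa [hw0] using h v hv

lemma denseRange_resolventCLM_sq :
    DenseRange fun k : Lp ℝ 2 μ => resolventCLM μ 1 (resolventCLM μ 1 k) := by
  set T := resolventCLM μ 1 ∘L resolventCLM μ 1 with hT
  have : T.range.topologicalClosure = ⊤ := by
    rw [Submodule.topologicalClosure_eq_top_iff, Submodule.eq_bot_iff]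
    intro f hf
    have h0 : T f = 0 := by
      refine ext_inner_left ℝ fun g => ?_
      have := hf (T g) ⟨g, rfl⟩
      rw [hT] at this ⊢
      simp only [ContinuousLinearMap.comp_apply, inner_resolventCLM] at this ⊢
      simpa using this
    exact resolventCLM_injective 1 (resolventCLM_injective 1 h0)
  have h2 := (Submodule.dense_iff_topologicalClosure_eq_top (s := T.range)).2 this
  exact h2

lemma tendsto_resolvent_semigroupL2 {t : ℝ} (ht : 0 ≤ t) (f : Lp ℝ 2 μ) :
    Tendsto (fun n : ℕ => (resolventCLM μ (t / n) ^ n) f) atTop (𝓝 (semigroupL2 μ t f)) := by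
  have e : ∀ n : ℕ, (resolventCLM μ (t / n) ^ n) f = (resolvent μ (t / n))^[n] f := fun n => by
    exact congrFun (hom_coe_pow (fun T : Lp ℝ 2 μ →L[ℝ] Lp ℝ 2 μ => (T : Lp ℝ 2 μ → Lp ℝ 2 μ)) rfl
      (fun _ _ => rfl) _ n) f
  simp_rw [e]
  refine tendsto_nhds_limUnder ?_
  simp_rw [← e]
  rcases ht.eq_or_lt with rfl | ht
  · refine ⟨f, tendsto_const_nhds.congr fun n => ?_⟩
    have : resolventCLM μ 0 = 1 := by
      ext1 g
      exact resolventCLM_zero g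
    rw [zero_div, this, one_pow]
    rfl
  · exact resolventIdentity_resolventCLM.exists_tendsto_pow (fun τ _ => norm_resolventCLM_le τ)
      denseRange_resolventCLM_sq ht f

end Dense

section Markov

variable [IsFiniteMeasure μ]

/-- The constant function `1` in `L²`. -/
noncomputable def oneL2 (μ : Measure (EuclideanSpace ℝ ι)) [IsFiniteMeasure μ] :
    Lp ℝ 2 μ :=
  (memLp_const (1 : ℝ)).toLp

omit [Fintype ι] in
lemma coeFn_oneL2 : oneL2 μ =ᵐ[μ] fun _ => 1 := (memLp_const (1 : ℝ)).coeFn_toLp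

lemma resolventCLM_one (τ : ℝ) : resolventCLM μ τ (oneL2 μ) = oneL2 μ :=
  resolventCLM_eq (const_one_mem_gradClosure _) fun v _ => by simp

lemma integral_resolventCLM (τ : ℝ) (f : Lp ℝ 2 μ) :
    ∫ x, resolventCLM μ τ f x ∂μ = ∫ x, f x ∂μ := by
  have e : ∀ g : Lp ℝ 2 μ, ∫ x, g x ∂μ = inner ℝ g (oneL2 μ) := fun g => by
    rw [L2.inner_def]
    refine integral_congr_ae ?_
    filter_upwards [coeFn_oneL2 (μ := μ)] with x hx
    simp [hx]
  rw [e, e, inner_resolventCLM, resolventCLM_one]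

/-- Testing the resolvent equation against a function of the solution. -/
lemma integral_sub_mul_comp_eq {τ : ℝ} {f : Lp ℝ 2 μ} {w : Lp (EuclideanSpace ℝ ι) 2 μ}
    (hw : WithLp.toLp 2 (resolventCLM μ τ f, w) ∈ gradClosure μ (Real.sqrt (τ / 2)))
    (h : ∀ v ∈ gradClosure μ (Real.sqrt (τ / 2)),
      inner ℝ (f - resolventCLM μ τ f) v.fst = inner ℝ w v.snd)
    {ψ : ℝ → ℝ} (hψ : ContDiff ℝ ∞ ψ) (hψ0 : ψ 0 = 0) {M : ℝ} (hM : ∀ s, |deriv ψ s| ≤ M) :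
    Integrable (fun x => (f x - resolventCLM μ τ f x) * ψ (resolventCLM μ τ f x)) μ ∧
    ∫ x, (f x - resolventCLM μ τ f x) * ψ (resolventCLM μ τ f x) ∂μ =
      ∫ x, deriv ψ (resolventCLM μ τ f x) * ‖w x‖ ^ 2 ∂μ := by
  obtain ⟨v, hv, hv1, hv2⟩ := exists_comp_mem_gradClosure hw hψ hψ0 hM
  have key := h v hv
  rw [L2.inner_def, L2.inner_def] at key
  have e1 : (fun x => inner ℝ ((f - resolventCLM μ τ f : Lp ℝ 2 μ) x) (v.fst x)) =ᵐ[μ]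
      fun x => (f x - resolventCLM μ τ f x) * ψ (resolventCLM μ τ f x) := by
    filter_upwards [hv1, Lp.coeFn_sub f (resolventCLM μ τ f)] with x hx hx'
    rw [hx, hx', Pi.sub_apply, WithLp.toLp_fst]
    simp [mul_comm]
  have e2 : (fun x => inner ℝ (w x) (v.snd x)) =ᵐ[μ]
      fun x => deriv ψ (resolventCLM μ τ f x) * ‖w x‖ ^ 2 := by
    filter_upwards [hv2] with x hx
    rw [hx, WithLp.toLp_fst, WithLp.toLp_snd, inner_smul_right, real_inner_self_eq_norm_sq]
  rw [integral_congr_ae e1, integral_congr_ae e2] at key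
  exact ⟨(L2.integrable_inner (𝕜 := ℝ) (f - resolventCLM μ τ f) v.fst).congr e1, key⟩

lemma exists_smooth_negativePart : ∃ ψ : ℝ → ℝ, ContDiff ℝ ∞ ψ ∧ (∀ s, 0 ≤ s → ψ s = 0) ∧
    (∀ s < 0, ψ s < 0) ∧ (∀ s, 0 ≤ deriv ψ s) ∧ ∃ M, ∀ s, |deriv ψ s| ≤ M := by
  set ψ : ℝ → ℝ := fun s => -Real.smoothTransition (-s) with hψd
  have hψ : ContDiff ℝ ∞ ψ := (Real.smoothTransition.contDiff.comp contDiff_neg).neg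
  have hmono : Monotone ψ := fun s r hsr =>
    neg_le_neg (Real.smoothTransition.monotone (neg_le_neg hsr))
  have hpos : ∀ s, 0 ≤ s → ψ s = 0 := fun s hs => by
    simp [hψd, Real.smoothTransition.zero_of_nonpos (neg_nonpos.2 hs)]
  refine ⟨ψ, hψ, hpos, fun s hs => ?_, fun s => hmono.deriv_nonneg, ?_⟩
  · simpa [hψd] using Real.smoothTransition.pos_of_pos (neg_pos.2 hs)
  · have hsupp : HasCompactSupport (deriv ψ) := by
      refine HasCompactSupport.intro (isCompact_Icc (a := -1) (b := 0)) fun s hs => ?_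
      rw [Set.mem_Icc, not_and_or, not_le, not_le] at hs
      rcases hs with hs | hs
      · have : ψ =ᶠ[𝓝 s] fun _ => -1 := by
          filter_upwards [Iio_mem_nhds hs] with r hr
          rw [Set.mem_Iio] at hr
          simp [hψd, Real.smoothTransition.one_of_one_le (show 1 ≤ -r by linarith)]
        rw [this.deriv_eq, deriv_const]
      · have : ψ =ᶠ[𝓝 s] fun _ => 0 := by
          filter_upwards [Ioi_mem_nhds hs] with r hr
          exact hpos r (le_of_lt hr)
        rw [this.deriv_eq, deriv_const]
    exact hsupp.exists_bound_of_continuous (hψ.continuous_deriv (by simp))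

/-- The resolvent preserves positivity: test the equation against a smooth version of the negative
part of the solution. -/
lemma resolventCLM_nonneg (τ : ℝ) {f : Lp ℝ 2 μ} (hf : ∀ᵐ x ∂μ, 0 ≤ f x) :
    ∀ᵐ x ∂μ, 0 ≤ resolventCLM μ τ f x := by
  obtain ⟨w, hw, h⟩ := exists_resolvent_weak τ f
  obtain ⟨ψ, hψ, hψ0, hψneg, hψd, M, hM⟩ := exists_smooth_negativePart
  obtain ⟨hint, key⟩ := integral_sub_mul_comp_eq hw h hψ (hψ0 0 le_rfl) hM
  have hnp : ∀ᵐ x ∂μ, (f x - resolventCLM μ τ f x) * ψ (resolventCLM μ τ f x) ≤ 0 := by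
    filter_upwards [hf] with x hx
    rcases le_or_gt 0 (resolventCLM μ τ f x) with h0 | h0
    · rw [hψ0 _ h0, mul_zero]
    · exact mul_nonpos_of_nonneg_of_nonpos (by linarith) (hψneg _ h0).le
  have hge : 0 ≤ ∫ x, (f x - resolventCLM μ τ f x) * ψ (resolventCLM μ τ f x) ∂μ := by
    rw [key]
    exact integral_nonneg fun x => mul_nonneg (hψd _) (by positivity)
  have hz : ∫ x, -((f x - resolventCLM μ τ f x) * ψ (resolventCLM μ τ f x)) ∂μ = 0 := by
    rw [integral_neg, neg_eq_zero]
    exact le_antisymm (integral_nonpos_of_ae hnp) hge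
  have hae := (integral_eq_zero_iff_of_nonneg_ae (by
    filter_upwards [hnp] with x hx
    simpa using hx) hint.neg).1 hz
  filter_upwards [hae, hf] with x hx hfx
  by_contra! hneg
  have := mul_neg_of_pos_of_neg (show 0 < f x - resolventCLM μ τ f x by linarith) (hψneg _ hneg)
  simp only [Pi.zero_apply, Pi.neg_apply] at hx
  linarith

lemma le_resolventCLM (τ : ℝ) {f : Lp ℝ 2 μ} {b : ℝ} (hf : ∀ᵐ x ∂μ, b ≤ f x) :
    ∀ᵐ x ∂μ, b ≤ resolventCLM μ τ f x := by
  have h : ∀ᵐ x ∂μ, 0 ≤ (f - b • oneL2 μ : Lp ℝ 2 μ) x := by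
    filter_upwards [hf, Lp.coeFn_sub f (b • oneL2 μ), Lp.coeFn_smul b (oneL2 μ),
      coeFn_oneL2 (μ := μ)] with x h1 h2 h3 h4
    rw [h2, Pi.sub_apply, h3, Pi.smul_apply, h4, smul_eq_mul]
    linarith
  have h' := resolventCLM_nonneg τ h
  rw [map_sub, map_smul, resolventCLM_one] at h'
  filter_upwards [h', Lp.coeFn_sub (resolventCLM μ τ f) (b • oneL2 μ), Lp.coeFn_smul b (oneL2 μ),
      coeFn_oneL2 (μ := μ)] with x h1 h2 h3 h4
  rw [h2, Pi.sub_apply, h3, Pi.smul_apply, h4, smul_eq_mul] at h1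
  linarith

lemma resolventCLM_le (τ : ℝ) {f : Lp ℝ 2 μ} {b : ℝ} (hf : ∀ᵐ x ∂μ, f x ≤ b) :
    ∀ᵐ x ∂μ, resolventCLM μ τ f x ≤ b := by
  have h : ∀ᵐ x ∂μ, -b ≤ (-f) x := by
    filter_upwards [hf, Lp.coeFn_neg f] with x h1 h2
    rw [h2, Pi.neg_apply]
    linarith
  have h' := le_resolventCLM τ h
  rw [map_neg] at h'
  filter_upwards [h', Lp.coeFn_neg (resolventCLM μ τ f)] with x h1 h2
  rw [h2, Pi.neg_apply] at h1
  linarith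

end Markov

end Resolvent


/-! ### Entropy and the Beckner functional -/

section EntropyDeficit

/-- The scalar inequality behind the comparison of entropy with Beckner's functional, in the
variable `z = δ log x`. The right side vanishes to second order at `z = 0`. -/
lemma scalar_exp_inequality {δ z : ℝ} (hδ : 0 < δ) (hδ8 : δ ≤ 1 / 8) (hz : Real.exp z ≤ 7 / 4) :
    0 ≤ 1 - Real.exp (-z) - z / 2 + δ / 2 * (Real.exp (-z / δ) - 1) := by
  set g : ℝ → ℝ := fun z => 1 - Real.exp (-z) - z / 2 + δ / 2 * (Real.exp (-z / δ) - 1) with hg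
  have hd : ∀ z, HasDerivAt g (Real.exp (-z) - 1 / 2 - Real.exp (-z / δ) / 2) z := fun z => by
    have h1 : HasDerivAt (fun z : ℝ => Real.exp (-z)) (Real.exp (-z) * -1) z :=
      (hasDerivAt_neg z).exp
    have h2 : HasDerivAt (fun z : ℝ => Real.exp (-z / δ)) (Real.exp (-z / δ) * (-1 / δ)) z :=
      ((hasDerivAt_neg z).div_const δ).exp
    have := ((h1.const_sub 1).sub ((hasDerivAt_id z).div_const 2)).add
      ((h2.sub_const 1).const_mul (δ / 2))
    refine this.congr_deriv ?_
    field_simp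
    ring
  have hcont : Continuous g := continuous_iff_continuousAt.2 fun z => (hd z).continuousAt
  have hg0 : g 0 = 0 := by simp [hg]
  have hpow : ∀ (k : ℕ) (y : ℝ), Real.exp (-y) ^ k = Real.exp (k * -y) := fun k y =>
    (Real.exp_nat_mul _ _).symm
  rcases le_total 0 z with h0 | h0
  · have hmono : MonotoneOn g (Set.Icc 0 z) := by
      refine monotoneOn_of_deriv_nonneg (convex_Icc 0 z) hcont.continuousOn
        (fun y _ => (hd y).differentiableAt.differentiableWithinAt) fun y hy => ?_
      rw [interior_Icc] at hy
      rw [(hd y).deriv]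
      set b := Real.exp (-y) with hb
      have hb1 : b ≤ 1 := Real.exp_le_one_iff.2 (by linarith [hy.1])
      have hb2 : 4 / 7 ≤ b := by
        rw [hb, Real.exp_neg, le_inv_comm₀ (by norm_num) (Real.exp_pos _)]
        have := Real.exp_le_exp.2 hy.2.le
        norm_num
        linarith
      have hb4 : Real.exp (-y / δ) ≤ b ^ 4 := by
        rw [hb, hpow, Real.exp_le_exp, div_le_iff₀ hδ]
        push_cast
        nlinarith [hy.1]
      have : 0 ≤ (1 - b) * (b ^ 3 + b ^ 2 + b - 1) := by
        refine mul_nonneg (by linarith) ?_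
        nlinarith [pow_le_pow_left₀ (by norm_num) hb2 3, pow_le_pow_left₀ (by norm_num) hb2 2]
      nlinarith
    have := hmono (Set.left_mem_Icc.2 h0) (Set.right_mem_Icc.2 h0) h0
    rwa [hg0] at this
  · have hanti : AntitoneOn g (Set.Icc z 0) := by
      refine antitoneOn_of_deriv_nonpos (convex_Icc z 0) hcont.continuousOn
        (fun y _ => (hd y).differentiableAt.differentiableWithinAt) fun y hy => ?_
      rw [interior_Icc] at hy
      rw [(hd y).deriv]
      set b := Real.exp (-y) with hb
      have hb2 : b ^ 2 ≤ Real.exp (-y / δ) := by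
        rw [hb, hpow, Real.exp_le_exp, le_div_iff₀ hδ]
        push_cast
        nlinarith [hy.2]
      nlinarith [sq_nonneg (1 - b)]
    have := hanti (Set.left_mem_Icc.2 h0) (Set.right_mem_Icc.2 h0) h0
    rwa [hg0] at this

/-- The choice `δ = 1 / (4 log K)` makes `x ^ δ` bounded by an absolute constant on `(0, K ^ 2]`. -/
lemma rpow_one_sub_le {K x : ℝ} (hK : Real.exp 2 ≤ K) (hx : 0 < x) (hxK : x ≤ K ^ 2) {δ : ℝ}
    (hδ : δ = 1 / (4 * Real.log K)) :
    x ^ (1 - δ) ≤ x - δ / 2 * (x * Real.log x) - δ / 2 * (x - 1) := by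
  have hK0 : 0 < K := (Real.exp_pos 2).trans_le hK
  have hlog : 2 ≤ Real.log K := (Real.le_log_iff_exp_le hK0).2 hK
  have hδ0 : 0 < δ := by rw [hδ]; positivity
  have hδ8 : δ ≤ 1 / 8 := by
    rw [hδ]
    exact one_div_le_one_div_of_le (by norm_num) (by linarith)
  have hz : Real.exp (δ * Real.log x) ≤ 7 / 4 := by
    have h1 : Real.log x ≤ 2 * Real.log K := by
      have := Real.log_le_log hx hxK
      rwa [Real.log_pow, Nat.cast_ofNat] at this
    have h2 : δ * Real.log x ≤ 1 / 2 := by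
      calc δ * Real.log x ≤ δ * (2 * Real.log K) := by gcongr
        _ = 1 / 2 := by rw [hδ]; field_simp; norm_num
    have h3 : Real.exp (1 / 2) ≤ 7 / 4 := by
      have : Real.exp (1 / 2) ^ 2 = Real.exp 1 := by
        rw [← Real.exp_nat_mul]
        norm_num
      nlinarith [Real.exp_one_lt_d9, Real.exp_pos (1 / 2)]
    exact (Real.exp_le_exp.2 h2).trans h3
  have key := scalar_exp_inequality hδ0 hδ8 hz
  have e1 : x ^ (1 - δ) = x * Real.exp (-(δ * Real.log x)) := by
    rw [Real.rpow_def_of_pos hx, mul_sub, mul_one, sub_eq_add_neg, Real.exp_add, Real.exp_log hx,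
      mul_comm (Real.log x)]
  have e2 : Real.exp (-(δ * Real.log x) / δ) = x⁻¹ := by
    rw [← mul_neg, mul_div_cancel_left₀ _ hδ0.ne', Real.exp_neg, Real.exp_log hx]
  rw [e2] at key
  have := mul_nonneg hx.le key
  rw [e1]
  have hxx : x * x⁻¹ = 1 := mul_inv_cancel₀ hx.ne'
  linear_combination this + (δ / 2) * hxx

variable {X : Type} [MeasurableSpace X] {μ : Measure X}

lemma integrable_comp_of_mem_Icc [IsFiniteMeasure μ] {g : ℝ → ℝ} (hg : Continuous g) {u : X → ℝ}
    (hu : AEStronglyMeasurable u μ) {b B : ℝ} (hub : ∀ᵐ x ∂μ, u x ∈ Set.Icc b B) :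
    Integrable (fun x => g (u x)) μ := by
  obtain ⟨D, hD⟩ := (isCompact_Icc (a := b) (b := B)).exists_bound_of_continuousOn hg.continuousOn
  refine Integrable.of_bound (hg.comp_aestronglyMeasurable hu) D ?_
  filter_upwards [hub] with x hx using hD _ hx

lemma entropy_congr_ae {u v : X → ℝ} (h : u =ᵐ[μ] v) : entropy μ u = entropy μ v := by
  have : (fun x => u x * Real.log (u x)) =ᵐ[μ] fun x => v x * Real.log (v x) := by
    filter_upwards [h] with x hx
    rw [hx]
  rw [entropy, entropy, integral_congr_ae h, integral_congr_ae this]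

lemma tendsto_entropy [IsFiniteMeasure μ] {u : ℕ → X → ℝ} {v : X → ℝ}
    (hu : ∀ n, AEStronglyMeasurable (u n) μ) {b B : ℝ}
    (hub : ∀ n, ∀ᵐ x ∂μ, u n x ∈ Set.Icc b B)
    (hlim : ∀ᵐ x ∂μ, Tendsto (fun n => u n x) atTop (𝓝 (v x))) :
    Tendsto (fun n => entropy μ (u n)) atTop (𝓝 (entropy μ v)) := by
  have key : ∀ g : ℝ → ℝ, Continuous g →
      Tendsto (fun n => ∫ x, g (u n x) ∂μ) atTop (𝓝 (∫ x, g (v x) ∂μ)) := by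
    intro g hg
    obtain ⟨D, hD⟩ := (isCompact_Icc (a := b) (b := B)).exists_bound_of_continuousOn
      hg.continuousOn
    refine tendsto_integral_of_dominated_convergence (fun _ => D)
      (fun n => hg.comp_aestronglyMeasurable (hu n)) (integrable_const D) (fun n => ?_) ?_
    · filter_upwards [hub n] with x hx using hD _ hx
    · filter_upwards [hlim] with x hx using (hg.tendsto _).comp hx
  have h1 := key id continuous_id
  exact (key _ Real.continuous_mul_log).sub ((Real.continuous_mul_log.tendsto _).comp h1)

/-- For a positive function bounded by `K ^ 2` times its mean, entropy is controlled by the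
functional of the generalized Beckner inequality with `p = 2 - 2 δ`, `δ = 1 / (4 log K)`, at the
square root of the function. -/
lemma entropy_le_beckner [IsProbabilityMeasure μ] {u : X → ℝ} (hu : AEStronglyMeasurable u μ)
    {K : ℝ} (hK : Real.exp 2 ≤ K) (hpos : ∀ᵐ x ∂μ, 0 < u x) (hm : 0 < ∫ x, u x ∂μ)
    (hb : ∀ᵐ x ∂μ, u x ≤ (∫ y, u y ∂μ) * K ^ 2) {δ : ℝ} (hδ : δ = 1 / (4 * Real.log K)) :
    δ / 2 * entropy μ u ≤ ∫ x, u x ∂μ - (∫ x, u x ^ (1 - δ) ∂μ) ^ (1 / (1 - δ)) := by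
  have hK0 : 0 < K := (Real.exp_pos 2).trans_le hK
  have hlog : 2 ≤ Real.log K := (Real.le_log_iff_exp_le hK0).2 hK
  have hδ0 : 0 < δ := by rw [hδ]; positivity
  have hδ8 : δ ≤ 1 / 8 := by
    rw [hδ]
    exact one_div_le_one_div_of_le (by norm_num) (by linarith)
  set m := ∫ x, u x ∂μ with hmdef
  have hIcc : ∀ᵐ x ∂μ, u x ∈ Set.Icc 0 (m * K ^ 2) := by
    filter_upwards [hpos, hb] with x h1 h2 using ⟨h1.le, h2⟩
  have i1 : Integrable u μ := integrable_comp_of_mem_Icc continuous_id hu hIcc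
  have i2 := integrable_comp_of_mem_Icc Real.continuous_mul_log hu hIcc
  have i3 := integrable_comp_of_mem_Icc
    (Real.continuous_rpow_const (q := 1 - δ) (by linarith)) hu hIcc
  have hEnt : entropy μ u = ∫ x, u x * Real.log (u x) ∂μ - m * Real.log m := rfl
  -- nonnegativity of entropy, from `x log x ≥ x - 1` at `x = u / m`
  have hnn : 0 ≤ entropy μ u := by
    have i4 : Integrable (fun x => u x - m) μ := i1.sub (integrable_const m)
    have : ∫ x, (u x * Real.log m + (u x - m)) ∂μ ≤ ∫ x, u x * Real.log (u x) ∂μ := by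
      refine integral_mono_ae ((i1.mul_const _).add i4) i2 ?_
      filter_upwards [hpos] with x hx
      have h1 := Real.one_sub_inv_le_log_of_pos (div_pos hx hm)
      rw [Real.log_div hx.ne' hm.ne', inv_div] at h1
      have h2 := mul_le_mul_of_nonneg_left h1 hx.le
      have h3 : u x * (1 - m / u x) = u x - m := by field_simp
      linarith
    rw [integral_add (i1.mul_const _) i4, integral_mul_const,
      integral_sub i1 (integrable_const m), integral_const, ← hmdef] at this
    simp only [probReal_univ, one_smul, sub_self, add_zero] at this
    rw [hEnt]
    linarith
  -- the scalar inequality at `x = u / m`, integrated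
  have hq : m ^ (-(1 - δ)) * ∫ x, u x ^ (1 - δ) ∂μ ≤ 1 - δ / 2 * (entropy μ u / m) := by
    rw [← integral_const_mul]
    have i5 : Integrable (fun x => (m⁻¹ * (1 + δ / 2 * (Real.log m - 1))) * u x
        - (δ / 2 * m⁻¹) * (u x * Real.log (u x))) μ := (i1.const_mul _).sub (i2.const_mul _)
    have : ∫ x, m ^ (-(1 - δ)) * u x ^ (1 - δ) ∂μ ≤
        ∫ x, ((m⁻¹ * (1 + δ / 2 * (Real.log m - 1))) * u x
          - (δ / 2 * m⁻¹) * (u x * Real.log (u x)) + δ / 2) ∂μ := by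
      refine integral_mono_ae (i3.const_mul _) (i5.add (integrable_const _)) ?_
      filter_upwards [hpos, hb] with x hx hxb
      have h1 := rpow_one_sub_le hK (div_pos hx hm)
        ((div_le_iff₀ hm).2 (by rwa [mul_comm] at hxb)) hδ
      rw [Real.log_div hx.ne' hm.ne', Real.div_rpow hx.le hm.le] at h1
      rw [Real.rpow_neg hm.le]
      calc _ = u x ^ (1 - δ) / m ^ (1 - δ) := by rw [div_eq_inv_mul]
        _ ≤ _ := h1
        _ = _ := by rw [div_eq_inv_mul]; ring
    refine this.trans_eq ?_
    rw [integral_add i5 (integrable_const _), integral_sub (i1.const_mul _) (i2.const_mul _),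
      integral_const_mul, integral_const_mul, integral_const, ← hmdef, hEnt]
    simp only [probReal_univ, one_smul]
    field_simp
    ring
  set I := ∫ x, u x ^ (1 - δ) ∂μ with hI
  have hI0 : 0 ≤ I := integral_nonneg_of_ae (by
    filter_upwards [hpos] with x hx
    exact Real.rpow_nonneg hx.le _)
  set q := m ^ (-(1 - δ)) * I with hqdef
  have hq0 : 0 ≤ q := by positivity
  have hq1 : q ≤ 1 := hq.trans (by
    have : 0 ≤ δ / 2 * (entropy μ u / m) := by positivity
    linarith)
  have hI' : I = m ^ (1 - δ) * q := by
    rw [hqdef, Real.rpow_neg hm.le, mul_inv_cancel_left₀ (Real.rpow_pos_of_pos hm _).ne']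
  have hpow : I ^ (1 / (1 - δ)) = m * q ^ (1 / (1 - δ)) := by
    rw [hI', Real.mul_rpow (Real.rpow_nonneg hm.le _) hq0, ← Real.rpow_mul hm.le,
      mul_one_div_cancel (by linarith), Real.rpow_one]
  have hqq : q ^ (1 / (1 - δ)) ≤ q := by
    have h1 : (1 : ℝ) ≤ 1 / (1 - δ) := by
      rw [le_div_iff₀ (by linarith)]
      linarith
    exact Real.rpow_le_self_of_le_one hq0 hq1 h1
  rw [hpow]
  have h2 : m * q ≤ m * (1 - δ / 2 * (entropy μ u / m)) := by gcongr
  have h3 : m * (1 - δ / 2 * (entropy μ u / m)) = m - δ / 2 * entropy μ u := by field_simp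
  have h4 : m * q ^ (1 / (1 - δ)) ≤ m * q := by gcongr
  linarith

end EntropyDeficit

/-! ### Entropy decay in one resolvent step -/

section EntropyStep

/-- A function which is smooth on `(0, ∞)` agrees on `[ε, B]` with a smooth function on `ℝ` which
vanishes at `0` and has a bounded derivative. -/
lemma exists_smooth_extension {φ : ℝ → ℝ} (hφ : ∀ s, 0 < s → ContDiffAt ℝ ∞ φ s) {ε B : ℝ}
    (hε : 0 < ε) (hB : ε ≤ B) :
    ∃ ψ : ℝ → ℝ, ContDiff ℝ ∞ ψ ∧ ψ 0 = 0 ∧ (∃ M, ∀ s, |deriv ψ s| ≤ M) ∧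
      ∀ s ∈ Set.Icc ε B, ψ s = φ s ∧ deriv ψ s = deriv φ s := by
  let χ : ContDiffBump ((ε + B) / 2) :=
    ⟨(B - ε) / 2 + ε / 4, (B - ε) / 2 + ε / 2, by linarith, by linarith⟩
  have hzero : ∀ s, s < ε / 2 → χ s = 0 := fun s hs => by
    refine χ.zero_of_le_dist ?_
    rw [Real.dist_eq, abs_of_nonpos (by linarith)]
    simp only [χ]
    linarith
  have hsm : ContDiff ℝ ∞ fun s => χ s * φ s := by
    rw [contDiff_iff_contDiffAt]
    intro s
    rcases lt_or_ge 0 s with hs | hs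
    · exact χ.contDiff.contDiffAt.mul (hφ s hs)
    · have : (fun s => χ s * φ s) =ᶠ[𝓝 s] fun _ => 0 := by
        filter_upwards [Iio_mem_nhds (show s < ε / 2 by linarith)] with r hr
        rw [hzero r hr, zero_mul]
      exact contDiffAt_const.congr_of_eventuallyEq this
  refine ⟨fun s => χ s * φ s, hsm, ?_, ?_, fun s hs => ?_⟩
  · simp [hzero 0 (by linarith)]
  · have hc : HasCompactSupport fun s => χ s * φ s := χ.hasCompactSupport.mul_right
    exact hc.deriv.exists_bound_of_continuous (hsm.continuous_deriv (by simp))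
  · have hone : (fun s => χ s * φ s) =ᶠ[𝓝 s] φ := by
      have : s ∈ Metric.ball ((ε + B) / 2) χ.rIn := by
        rw [Metric.mem_ball, Real.dist_eq, abs_lt]
        simp only [χ]
        constructor <;> linarith [hs.1, hs.2]
      filter_upwards [χ.eventuallyEq_one_of_mem_ball this] with r hr
      simp [hr]
    exact ⟨hone.eq_of_nhds, hone.deriv_eq⟩

/-- Convexity of `x log x`, integrated. -/
lemma integral_sub_mul_log_le_entropy_sub {X : Type} [MeasurableSpace X] {μ : Measure X}
    [IsFiniteMeasure μ] {f u : X → ℝ} (hf : AEStronglyMeasurable f μ)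
    (hu : AEStronglyMeasurable u μ) {B : ℝ} (hfb : ∀ᵐ x ∂μ, f x ∈ Set.Icc 0 B)
    (hub : ∀ᵐ x ∂μ, u x ∈ Set.Icc 0 B) (hf0 : ∀ᵐ x ∂μ, 0 < f x) (hu0 : ∀ᵐ x ∂μ, 0 < u x)
    (hfu : ∫ x, u x ∂μ = ∫ x, f x ∂μ) (hi : Integrable (fun x => (f x - u x) * Real.log (u x)) μ) :
    ∫ x, (f x - u x) * Real.log (u x) ∂μ ≤ entropy μ f - entropy μ u := by
  have i1 : Integrable f μ := integrable_comp_of_mem_Icc continuous_id hf hfb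
  have i2 : Integrable u μ := integrable_comp_of_mem_Icc continuous_id hu hub
  have j1 := integrable_comp_of_mem_Icc Real.continuous_mul_log hf hfb
  have j2 := integrable_comp_of_mem_Icc Real.continuous_mul_log hu hub
  have i3 : Integrable (fun x => f x - u x) μ := i1.sub i2
  have key : ∫ x, ((f x - u x) * Real.log (u x) + (f x - u x)) ∂μ ≤
      ∫ x, (f x * Real.log (f x) - u x * Real.log (u x)) ∂μ := by
    refine integral_mono_ae (hi.add i3) (j1.sub j2) ?_
    filter_upwards [hf0, hu0] with x hx hy
    have h1 := Real.one_sub_inv_le_log_of_pos (div_pos hx hy)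
    rw [Real.log_div hx.ne' hy.ne', inv_div] at h1
    have h2 := mul_le_mul_of_nonneg_left h1 hx.le
    have h3 : f x * (1 - u x / f x) = f x - u x := by field_simp
    linarith
  rw [integral_add hi i3, integral_sub i1 i2, integral_sub j1 j2, hfu, sub_self,
    add_zero] at key
  rw [entropy, entropy, hfu]
  linarith

variable {ι : Type} [Fintype ι] {μ : Measure (EuclideanSpace ℝ ι)} [IsProbabilityMeasure μ]

/-- One implicit Euler step decreases entropy by a fixed factor. Testing the resolvent equation
`f - u = -τ L u` against `log u` produces `(τ/2) ∫ |∇u|² / u = 2 τ ∫ |∇√u|²`, which the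
generalized Beckner inequality for `√u` bounds below. -/
lemma entropy_resolventCLM_le {a C : ℝ} (hC : 0 < C) (hG : GBI μ a C) {K : ℝ}
    (hK : Real.exp 2 ≤ K) {τ : ℝ} (hτ : 0 ≤ τ) {f : Lp ℝ 2 μ} {ε B : ℝ} (hε : 0 < ε)
    (hfε : ∀ᵐ x ∂μ, ε ≤ f x) (hfB : ∀ᵐ x ∂μ, f x ≤ B) (hB : B ≤ (∫ x, f x ∂μ) * K ^ 2) :
    entropy μ (resolventCLM μ τ f) *
      (1 + τ / (C * 2 ^ a * 4 ^ (1 - a) * Real.log K ^ (1 - a))) ≤ entropy μ f := by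
  obtain ⟨w, hw, hweak⟩ := exists_resolvent_weak τ f
  have huε := le_resolventCLM τ hfε
  have huB := resolventCLM_le τ hfB
  have hmass := integral_resolventCLM τ f
  have hint := @integral_sub_mul_comp_eq _ _ _ _ _ _ _ hw hweak
  set u := resolventCLM μ τ f
  have hεB : ε ≤ B := by
    obtain ⟨x, h1, h2⟩ := (hfε.and hfB).exists
    exact h1.trans h2
  have hu : AEStronglyMeasurable u μ := Lp.aestronglyMeasurable u
  have hIcc : ∀ᵐ x ∂μ, u x ∈ Set.Icc ε B := by
    filter_upwards [huε, huB] with x h1 h2 using ⟨h1, h2⟩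
  have hpos : ∀ᵐ x ∂μ, 0 < u x := by filter_upwards [huε] with x hx using hε.trans_le hx
  have hK0 : 0 < K := (Real.exp_pos 2).trans_le hK
  have hlog : 2 ≤ Real.log K := (Real.le_log_iff_exp_le hK0).2 hK
  obtain ⟨δ, hδ⟩ : ∃ δ, δ = 1 / (4 * Real.log K) := ⟨_, rfl⟩
  have hδ0 : 0 < δ := by rw [hδ]; positivity
  have hδ8 : δ ≤ 1 / 8 := by
    rw [hδ]
    exact one_div_le_one_div_of_le (by norm_num) (by linarith)
  -- entropy production
  have hprod : ∫ x, (u x)⁻¹ * ‖w x‖ ^ 2 ∂μ ≤ entropy μ f - entropy μ u := by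
    obtain ⟨ψ, hψ, hψ0, ⟨M, hM⟩, hψe⟩ :=
      exists_smooth_extension (φ := Real.log) (fun s hs => Real.contDiffAt_log.2 hs.ne') hε hεB
    obtain ⟨h1, h2⟩ := hint hψ hψ0 hM
    have e1 : (fun x => (f x - u x) * ψ (u x)) =ᵐ[μ] fun x => (f x - u x) * Real.log (u x) := by
      filter_upwards [hIcc] with x hx
      rw [(hψe _ hx).1]
    have e2 : (fun x => deriv ψ (u x) * ‖w x‖ ^ 2) =ᵐ[μ] fun x => (u x)⁻¹ * ‖w x‖ ^ 2 := by
      filter_upwards [hIcc] with x hx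
      rw [(hψe _ hx).2, Real.deriv_log]
    rw [integral_congr_ae e1, integral_congr_ae e2] at h2
    rw [← h2]
    refine integral_sub_mul_log_le_entropy_sub (B := B) (Lp.aestronglyMeasurable f) hu ?_ ?_ ?_
      hpos hmass (h1.congr e1)
    · filter_upwards [hfε, hfB] with x h1 h2 using ⟨hε.le.trans h1, h2⟩
    · filter_upwards [hIcc] with x hx using ⟨hε.le.trans hx.1, hx.2⟩
    · filter_upwards [hfε] with x hx using hε.trans_le hx
  -- the generalized Beckner inequality for `√u`
  have hgbi : τ / 2 * (∫ x, u x ∂μ - (∫ x, u x ^ (1 - δ) ∂μ) ^ (1 / (1 - δ))) ≤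
      C * (2 * δ) ^ a * (1 / 4 * ∫ x, (u x)⁻¹ * ‖w x‖ ^ 2 ∂μ) := by
    obtain ⟨ψ, hψ, hψ0, ⟨M, hM⟩, hψe⟩ :=
      exists_smooth_extension (φ := Real.sqrt) (fun s hs => Real.contDiffAt_sqrt hs.ne') hε hεB
    obtain ⟨v, hv, hv1, hv2⟩ := exists_comp_mem_gradClosure hw hψ hψ0 hM
    have key := hG.of_mem_gradClosure hv (p := 2 - 2 * δ) (by linarith) (by linarith)
    have i1 : ∫ x, v.fst x ^ 2 ∂μ = ∫ x, u x ∂μ := by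
      refine integral_congr_ae ?_
      filter_upwards [hv1, hIcc, hpos] with x h1 h2 h3
      rw [h1, WithLp.toLp_fst, (hψe _ h2).1, Real.sq_sqrt h3.le]
    have i2 : ∫ x, |v.fst x| ^ (2 - 2 * δ) ∂μ = ∫ x, u x ^ (1 - δ) ∂μ := by
      refine integral_congr_ae ?_
      filter_upwards [hv1, hIcc, hpos] with x h1 h2 h3
      rw [h1, WithLp.toLp_fst, (hψe _ h2).1, abs_of_nonneg (Real.sqrt_nonneg _),
        Real.sqrt_eq_rpow, ← Real.rpow_mul h3.le]
      congr 1
      ring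
    have i3 : ∫ x, ‖v.snd x‖ ^ 2 ∂μ = 1 / 4 * ∫ x, (u x)⁻¹ * ‖w x‖ ^ 2 ∂μ := by
      rw [← integral_const_mul]
      refine integral_congr_ae ?_
      filter_upwards [hv2, hIcc, hpos] with x h1 h2 h3
      rw [h1, WithLp.toLp_fst, WithLp.toLp_snd, (hψe _ h2).2, (Real.hasDerivAt_sqrt h3.ne').deriv,
        norm_smul, mul_pow, Real.norm_eq_abs, sq_abs, div_pow, mul_pow, Real.sq_sqrt h3.le]
      field_simp
      ring
    have e : (2 : ℝ) / (2 - 2 * δ) = 1 / (1 - δ) := by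
      rw [div_eq_div_iff (by linarith) (by linarith)]
      ring
    rwa [i1, i2, i3, Real.sq_sqrt (by positivity), e, sub_sub_cancel] at key
  have hm : 0 < ∫ x, u x ∂μ := by
    have : ∫ _, ε ∂μ ≤ ∫ x, u x ∂μ := integral_mono_ae (integrable_const ε)
      (integrable_comp_of_mem_Icc continuous_id hu hIcc) huε
    rw [integral_const, probReal_univ, one_smul] at this
    linarith
  have hent := entropy_le_beckner hu hK hpos hm (by
    filter_upwards [huB] with x hx
    rw [hmass]
    exact hx.trans hB) hδ
  -- the constants
  have hP : 0 < (2 * δ) ^ a := Real.rpow_pos_of_pos (by positivity) _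
  have hcst : (C * 2 ^ a * 4 ^ (1 - a) * Real.log K ^ (1 - a))⁻¹ * (C * (2 * δ) ^ a) = δ := by
    have h4 : (4 : ℝ) ^ (1 - a) * Real.log K ^ (1 - a) = δ⁻¹ ^ (1 - a) := by
      rw [← Real.mul_rpow (by norm_num) (by linarith), hδ, one_div, inv_inv]
    have h5 : δ⁻¹ ^ (1 - a) = δ⁻¹ * δ ^ a := by
      rw [Real.rpow_sub (by positivity), Real.rpow_one, Real.inv_rpow hδ0.le, div_inv_eq_mul]
    have h6 : (0 : ℝ) < 2 ^ a := Real.rpow_pos_of_pos two_pos _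
    have h7 : 0 < δ ^ a := Real.rpow_pos_of_pos hδ0 _
    rw [mul_assoc, h4, h5, Real.mul_rpow two_pos.le hδ0.le]
    field_simp
  set D := C * 2 ^ a * 4 ^ (1 - a) * Real.log K ^ (1 - a) with hD
  have hD0 : 0 < D := by
    have h1 : (0 : ℝ) < 2 ^ a := Real.rpow_pos_of_pos two_pos _
    have h2 : (0 : ℝ) < 4 ^ (1 - a) := Real.rpow_pos_of_pos (by norm_num) _
    have h3 : (0 : ℝ) < Real.log K ^ (1 - a) := Real.rpow_pos_of_pos (by linarith) _
    positivity
  set J := ∫ x, (u x)⁻¹ * ‖w x‖ ^ 2 ∂μ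
  have h1 : τ / 2 * (δ / 2 * entropy μ u) ≤ C * (2 * δ) ^ a * (1 / 4 * J) :=
    (mul_le_mul_of_nonneg_left hent (by positivity)).trans hgbi
  have h2 : C * (2 * δ) ^ a = D * δ :=
    (inv_mul_eq_iff_eq_mul₀ hD0.ne').1 hcst
  rw [h2] at h1
  have h3 : τ * entropy μ u ≤ D * J := by
    have : δ * (τ * entropy μ u) ≤ δ * (D * J) := by linarith
    exact le_of_mul_le_mul_left this hδ0
  have h4 : τ / D * entropy μ u ≤ J := by
    rw [div_mul_eq_mul_div, div_le_iff₀ hD0]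
    linarith
  linarith

end EntropyStep


/-! ### Entropy decay along the semigroup -/

section Decay

variable {ι : Type} [Fintype ι] {μ : Measure (EuclideanSpace ℝ ι)} [IsProbabilityMeasure μ]
  {a C K : ℝ}

omit [Fintype ι] in
omit [Fintype ι] in
lemma coeFn_add_smul_oneL2 (f : Lp ℝ 2 μ) (s : ℝ) :
    (f + s • oneL2 μ : Lp ℝ 2 μ) =ᵐ[μ] fun x => f x + s := by
  filter_upwards [Lp.coeFn_add f (s • oneL2 μ), Lp.coeFn_smul s (oneL2 μ),
    coeFn_oneL2 (μ := μ)] with x h1 h2 h3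
  rw [h1, Pi.add_apply, h2, Pi.smul_apply, h3, smul_eq_mul, mul_one]

lemma entropy_resolventCLM_pow_le (hC : 0 < C) (hG : GBI μ a C) (hK : Real.exp 2 ≤ K) {τ : ℝ}
    (hτ : 0 ≤ τ) {ε B : ℝ} (hε : 0 < ε) (n : ℕ) {f : Lp ℝ 2 μ} (hfε : ∀ᵐ x ∂μ, ε ≤ f x)
    (hfB : ∀ᵐ x ∂μ, f x ≤ B) (hB : B ≤ (∫ x, f x ∂μ) * K ^ 2) :
    entropy μ ((resolventCLM μ τ ^ n) f) *
      (1 + τ / (C * 2 ^ a * 4 ^ (1 - a) * Real.log K ^ (1 - a))) ^ n ≤ entropy μ f := by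
  have hlog : 0 ≤ Real.log K := Real.log_nonneg ((Real.one_le_exp (by norm_num)).trans hK)
  induction n generalizing f with
  | zero => simp
  | succ n ih =>
    have h1 := ih (le_resolventCLM τ hfε) (resolventCLM_le τ hfB)
      (by rwa [integral_resolventCLM])
    have h2 := entropy_resolventCLM_le hC hG hK hτ hε hfε hfB hB
    rw [pow_succ, mul_apply_eq_comp, pow_succ, ← mul_assoc]
    exact (mul_le_mul_of_nonneg_right h1 (by positivity)).trans h2

omit [Fintype ι] in
lemma tendsto_entropy_add_const {f : Lp ℝ 2 μ} {B : ℝ} (hf0 : ∀ᵐ x ∂μ, 0 ≤ f x)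
    (hfB : ∀ᵐ x ∂μ, f x ≤ B) :
    Tendsto (fun k : ℕ => entropy μ (f + (1 / ((k : ℝ) + 1)) • oneL2 μ : Lp ℝ 2 μ)) atTop
      (𝓝 (entropy μ f)) := by
  have hae : ∀ᵐ x ∂μ, ∀ k : ℕ,
      (f + (1 / ((k : ℝ) + 1)) • oneL2 μ : Lp ℝ 2 μ) x = f x + 1 / ((k : ℝ) + 1) :=
    ae_all_iff.2 fun k => coeFn_add_smul_oneL2 f _
  refine tendsto_entropy (b := 0) (B := B + 1) (fun k => Lp.aestronglyMeasurable _) (fun k => ?_) ?_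
  · filter_upwards [hae, hf0, hfB] with x h1 h2 h3
    have h4 : 1 / ((k : ℝ) + 1) ≤ 1 := by
      rw [div_le_one (by positivity)]
      simp
    have h5 : 0 ≤ 1 / ((k : ℝ) + 1) := by positivity
    rw [h1]
    constructor <;> linarith
  · filter_upwards [hae] with x h1
    simp_rw [h1]
    simpa using (tendsto_one_div_add_atTop_nhds_zero_nat (𝕜 := ℝ)).const_add (f x)

/-- Entropy decay along implicit Euler steps without a lower bound on the initial function: add a
constant, which the resolvent preserves, and let it tend to `0`. -/
lemma entropy_resolventCLM_pow_le_of_nonneg (hC : 0 < C) (hG : GBI μ a C) (hK : Real.exp 2 ≤ K)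
    {τ : ℝ} (hτ : 0 ≤ τ) (n : ℕ) {f : Lp ℝ 2 μ} (hf0 : ∀ᵐ x ∂μ, 0 ≤ f x)
    (hfK : ∀ᵐ x ∂μ, f x ≤ K) (hm : 1 / 2 ≤ ∫ x, f x ∂μ) :
    (∀ᵐ x ∂μ, (resolventCLM μ τ ^ n) f x ∈ Set.Icc 0 K) ∧
    entropy μ ((resolventCLM μ τ ^ n) f) *
      (1 + τ / (C * 2 ^ a * 4 ^ (1 - a) * Real.log K ^ (1 - a))) ^ n ≤ entropy μ f := by
  have hK2 : 2 ≤ K := by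
    have := Real.add_one_le_exp 2
    linarith
  have hbd : ∀ n : ℕ, ∀ᵐ x ∂μ, (resolventCLM μ τ ^ n) f x ∈ Set.Icc 0 K := by
    intro n
    induction n with
    | zero => filter_upwards [hf0, hfK] with x h1 h2 using ⟨h1, h2⟩
    | succ n ih =>
      rw [pow_succ', mul_apply_eq_comp]
      filter_upwards [le_resolventCLM τ (ih.mono fun x hx => hx.1),
        resolventCLM_le τ (ih.mono fun x hx => hx.2)] with x h1 h2 using ⟨h1, h2⟩
  have hone : ∀ n : ℕ, (resolventCLM μ τ ^ n) (oneL2 μ) = oneL2 μ := by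
    intro n
    induction n with
    | zero => rfl
    | succ n ih => rw [pow_succ, mul_apply_eq_comp, resolventCLM_one, ih]
  refine ⟨hbd n, le_of_tendsto_of_tendsto'
    ((tendsto_entropy_add_const ((hbd n).mono fun x hx => hx.1)
      ((hbd n).mono fun x hx => hx.2)).mul_const _)
    (tendsto_entropy_add_const hf0 hfK) fun k => ?_⟩
  set s : ℝ := 1 / ((k : ℝ) + 1) with hs
  have hs0 : 0 < s := by positivity
  have e : (resolventCLM μ τ ^ n) f + s • oneL2 μ = (resolventCLM μ τ ^ n) (f + s • oneL2 μ) := by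
    rw [map_add, map_smul, hone]
  rw [e]
  have hae := coeFn_add_smul_oneL2 f s
  refine entropy_resolventCLM_pow_le hC hG hK hτ (B := K + s) hs0 n ?_ ?_ ?_
  · filter_upwards [hae, hf0] with x h1 h2
    rw [h1]
    linarith
  · filter_upwards [hae, hfK] with x h1 h2
    rw [h1]
    linarith
  · rw [integral_congr_ae hae, integral_add ((Lp.memLp f).integrable (by norm_num))
      (integrable_const s), integral_const, probReal_univ, one_smul]
    have h1 : (1 / 2 + s) * K ^ 2 ≤ ((∫ x, f x ∂μ) + s) * K ^ 2 := by gcongr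
    have h2 : 2 * K ≤ K ^ 2 := by nlinarith
    have h3 : s * 1 ≤ s * K ^ 2 := by
      gcongr
      linarith
    linarith

theorem entropy_semigroupL2_le (hC : 0 < C) (hG : GBI μ a C) (hK : Real.exp 2 ≤ K)
    {t : ℝ} (ht : 0 ≤ t) {f : Lp ℝ 2 μ} (hf0 : ∀ᵐ x ∂μ, 0 ≤ f x) (hfK : ∀ᵐ x ∂μ, f x ≤ K)
    (hm : 1 / 2 ≤ ∫ x, f x ∂μ) :
    entropy μ (semigroupL2 μ t f) ≤ entropy μ f *
      Real.exp (-(t / (C * 2 ^ a * 4 ^ (1 - a) * Real.log K ^ (1 - a)))) := by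
  set D := C * 2 ^ a * 4 ^ (1 - a) * Real.log K ^ (1 - a) with hD
  have hlim := tendsto_resolvent_semigroupL2 ht f
  obtain ⟨ns, hns, hae⟩ := (tendstoInMeasure_of_tendsto_Lp hlim).exists_seq_tendsto_ae
  have key := fun n : ℕ => entropy_resolventCLM_pow_le_of_nonneg hC hG hK
    (τ := t / n) (by positivity) n hf0 hfK hm
  have l1 := tendsto_entropy (fun k => Lp.aestronglyMeasurable _) (fun k => (key (ns k)).1) hae
  have l2 := (Real.tendsto_one_add_div_pow_exp (t / D)).comp hns.tendsto_atTop
  have h : entropy μ (semigroupL2 μ t f) * Real.exp (t / D) ≤ entropy μ f := by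
    refine le_of_tendsto' (l1.mul l2) fun k => ?_
    have := (key (ns k)).2
    rwa [← hD, div_right_comm] at this
  rw [Real.exp_neg, ← div_eq_mul_inv, le_div_iff₀ (Real.exp_pos _)]
  exact h

end Decay

/-! ### Truncation of a density -/

section Truncation

variable {X : Type} [MeasurableSpace X] {μ : Measure X} {h : X → ℝ} {K : ℝ}

lemma IsBoundedDensity.aestronglyMeasurable_indicator (hh : IsBoundedDensity μ h) :
    AEStronglyMeasurable (Set.indicator {x | h x ≤ K} h) μ :=
  (hh.aemeasurable.indicator₀
    (nullMeasurableSet_le hh.aemeasurable aemeasurable_const)).aestronglyMeasurable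

lemma IsBoundedDensity.indicator_mem_Icc (hh : IsBoundedDensity μ h) (hK : 0 ≤ K) :
    ∀ᵐ x ∂μ, Set.indicator {x | h x ≤ K} h x ∈ Set.Icc 0 K := by
  filter_upwards [hh.nonneg] with x hx
  by_cases hxK : h x ≤ K
  · rw [Set.indicator_of_mem (by exact hxK)]
    exact ⟨hx, hxK⟩
  · rw [Set.indicator_of_notMem (by exact hxK)]
    exact ⟨le_rfl, hK⟩

lemma sub_one_le_mul_log {x : ℝ} (hx : 0 ≤ x) : x - 1 ≤ x * Real.log x := by
  rcases hx.eq_or_lt with rfl | hx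
  · simp
  · have h1 := mul_le_mul_of_nonneg_left (Real.one_sub_inv_le_log_of_pos hx) hx.le
    rwa [mul_sub, mul_one, mul_inv_cancel₀ hx.ne'] at h1

/-- Truncating a probability density at a level `K ≥ e²` does not increase entropy, and if
`log K ≥ 4 Ent(h)` it keeps at least half of the mass. -/
lemma IsBoundedDensity.entropy_indicator_le [IsProbabilityMeasure μ] (hh : IsBoundedDensity μ h)
    (hK : Real.exp 2 ≤ K) :
    entropy μ (Set.indicator {x | h x ≤ K} h) ≤ entropy μ h ∧
    (4 * entropy μ h ≤ Real.log K → 1 / 2 ≤ ∫ x, Set.indicator {x | h x ≤ K} h x ∂μ) := by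
  have hK0 : 0 < K := (Real.exp_pos 2).trans_le hK
  have hlog : 2 ≤ Real.log K := (Real.le_log_iff_exp_le hK0).2 hK
  have hgI := hh.indicator_mem_Icc hK0.le
  have hgm := hh.aestronglyMeasurable_indicator (K := K)
  have hhm := hh.aemeasurable.aestronglyMeasurable
  obtain ⟨M, hM⟩ := hh.bounded
  have hhI : ∀ᵐ x ∂μ, h x ∈ Set.Icc 0 M := by
    filter_upwards [hh.nonneg, hM] with x h1 h2 using ⟨h1, h2⟩
  have hle : ∀ᵐ x ∂μ, Set.indicator {x | h x ≤ K} h x ≤ h x := by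
    filter_upwards [hh.nonneg] with x hx
    exact Set.indicator_le_self' (fun _ _ => hx) x
  have hpt : ∀ x, Set.indicator {x | h x ≤ K} h x * Real.log (Set.indicator {x | h x ≤ K} h x)
      + Real.log K * (h x - Set.indicator {x | h x ≤ K} h x) ≤ h x * Real.log (h x) := by
    intro x
    by_cases hxK : h x ≤ K
    · rw [Set.indicator_of_mem (by exact hxK)]
      simp
    · rw [Set.indicator_of_notMem (by exact hxK)]
      push Not at hxK
      have := mul_le_mul_of_nonneg_left (Real.log_le_log hK0 hxK.le) (hK0.trans hxK).le
      linarith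
  set g := Set.indicator {x | h x ≤ K} h
  have i1 : Integrable g μ := integrable_comp_of_mem_Icc continuous_id hgm hgI
  have i2 : Integrable h μ := integrable_comp_of_mem_Icc continuous_id hhm hhI
  have j1 := integrable_comp_of_mem_Icc Real.continuous_mul_log hgm hgI
  have j2 := integrable_comp_of_mem_Icc Real.continuous_mul_log hhm hhI
  have i3 : Integrable (fun x => h x - g x) μ := i2.sub i1
  have hH : entropy μ h = ∫ x, h x * Real.log (h x) ∂μ := by
    rw [entropy, hh.integral_eq_one, Real.log_one, mul_zero, sub_zero]
  have hE : entropy μ g = ∫ x, g x * Real.log (g x) ∂μ -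
    (∫ x, g x ∂μ) * Real.log (∫ x, g x ∂μ) := rfl
  set m := ∫ x, g x ∂μ with hm
  have hm0 : 0 ≤ m := integral_nonneg_of_ae (hgI.mono fun x hx => hx.1)
  have hm1 : m ≤ 1 := by
    rw [← hh.integral_eq_one]
    exact integral_mono_ae i1 i2 hle
  have k1 : ∫ x, g x * Real.log (g x) ∂μ + Real.log K * (1 - m) ≤ entropy μ h := by
    have := integral_mono (j1.add (i3.const_mul (Real.log K))) j2 hpt
    rw [hH]
    refine le_trans (le_of_eq ?_) this
    simp only [Pi.add_apply]
    rw [integral_add j1 (i3.const_mul _), integral_const_mul, integral_sub i2 i1,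
      hh.integral_eq_one]
  have k2 : m - 1 ≤ ∫ x, g x * Real.log (g x) ∂μ := by
    have i4 : Integrable (fun x => g x - 1) μ := i1.sub (integrable_const 1)
    have := integral_mono_ae i4 j1 (hgI.mono fun x hx => sub_one_le_mul_log hx.1)
    rw [integral_sub i1 (integrable_const 1), integral_const, probReal_univ, one_smul] at this
    exact this
  have k3 := sub_one_le_mul_log hm0
  constructor
  · rw [hE]
    nlinarith
  · intro h4
    by_contra! hlt
    nlinarith

end Truncation

end Beckner

theorem mainTheorem4 (a : ℝ) (ha0 : 0 < a) (ha1 : a < 1) (C : ℝ) (hC : 0 < C) :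
    ∃ C' : ℝ, 0 < C' ∧
      ∀ (ι : Type) [Fintype ι] (U : EuclideanSpace ℝ ι → ℝ), Continuous U →
        IsProbabilityMeasure (Beckner.gibbs U) → Beckner.GBI (Beckner.gibbs U) a C →
        ∀ h : EuclideanSpace ℝ ι → ℝ, Beckner.IsBoundedDensity (Beckner.gibbs U) h →
        ∀ K : ℝ, Real.exp 2 ≤ K → 4 * Beckner.entropy (Beckner.gibbs U) h ≤ Real.log K →
        ∀ t : ℝ, 0 ≤ t →
          Beckner.entropy (Beckner.gibbs U)
              (Beckner.semigroup (Beckner.gibbs U) t (Set.indicator {x | h x ≤ K} h))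
            ≤ Beckner.entropy (Beckner.gibbs U) h
              * Real.exp (-(t / (C' * Real.log K ^ (1 - a)))) := by
  refine ⟨C * 2 ^ a * 4 ^ (1 - a), ?_, ?_⟩
  · have h1 : (0 : ℝ) < 2 ^ a := Real.rpow_pos_of_pos two_pos _
    have h2 : (0 : ℝ) < 4 ^ (1 - a) := Real.rpow_pos_of_pos (by norm_num) _
    positivity
  · intro ι _ U _ hμ hG h hh K hK h4 t ht
    have hK0 : 0 < K := (Real.exp_pos 2).trans_le hK
    have hgI := hh.indicator_mem_Icc hK0.le
    obtain ⟨hE, hm⟩ := hh.entropy_indicator_le hK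
    have hg2 : MemLp (Set.indicator {x | h x ≤ K} h) 2 (Beckner.gibbs U) :=
      memLp_of_bounded hgI hh.aestronglyMeasurable_indicator 2
    have hae := hg2.coeFn_toLp
    have key := Beckner.entropy_semigroupL2_le hC hG hK ht (f := hg2.toLp)
      (by filter_upwards [hae, hgI] with x h1 h2; rw [h1]; exact h2.1)
      (by filter_upwards [hae, hgI] with x h1 h2; rw [h1]; exact h2.2)
      (by rw [integral_congr_ae hae]; exact hm h4)
    rw [Beckner.entropy_congr_ae hae] at key
    rw [Beckner.semigroup, dif_pos hg2]
    exact key.trans (mul_le_mul_of_nonneg_right hE (Real.exp_pos _).le)
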